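/- **Setting.** Let $\varphi$ be a mixture density: a probability density on $[-1,1]$ with $\int_{-1}^1\frac{\varphi(x)}{1-x^2}\,dx<\infty$. Let $a^{(j)}$, $j\ge1$, be i.i.d. random variables with density $\varphi$. Let $\varepsilon^{(j)}_t$, $j\ge1$, $t\in\mathbb Z$, be i.i.d. with mean $0$ and variance $\sigma_\varepsilon^2\in(0,\infty)$, independent of the $a^{(j)}$. Let $Y^{(j)}$, $j\ge 1$, be the independent stationary solutions of $Y^{(j)}_t=a^{(j)}Y^{(j)}_{t-1}+\varepsilon^{(j)}_t$, $t\in\mathbb Z$. A process $X=(X_t)_{t\in\mathbb Z}$ is the aggregated process if its finite-dimensional distributions are the weak limits, as $N\to\infty$, of those of $N^{-1/2}\sum_{j=1}^N Y^{(j)}_t$. Put $$f(\lambda)=\frac{\sigma_\varepsilon^2}{2\pi}\int_{-1}^1\frac{\varphi(x)}{|1-xe^{i\lambda}|^2}\,dx ,\qquad \lambda\in[-\pi,\pi].$$ **Proposition.** Assume that $\varphi(x)=(1-x)^{1-2d}\psi(x)$ on $[-1,1]$ with $0<d<1/2$, where $\psi\ge0$, $\operatorname{supp}\psi\subset[-1,1]$,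 $\psi$ is continuous at $x=1$ (from the left) and $\psi(1)\neq0$. Assume moreover that either (i) $\operatorname{supp}\psi=[-1,1]$ and, for some $0<\tilde d<1/2$, the function $\psi(x)(1+x)^{2\tilde d-1}$ has a finite nonzero limit as $x\downarrow-1$; or (ii) $\operatorname{supp}\psi\subset[-a_*,1]$ for some $0<a_*<1$. Let $X$ be an aggregated process. Then $f$ is the spectral density of $X$ (so $X_t\in L^2$, $f\geq 0$ is integrable and $\operatorname{Cov}(X_{t+h},X_t)=\int_{-\pi}^{\pi}e^{ih\lambda}f(\lambda)\,d\lambda$), $f>0$ almost everywhere, $\log f$ is integrable on $[-\pi,\pi]$ (so $\int_{-\pi}^\pi\log f(\lambda)\,d\lambda>-\infty$), and $X$ has the one-sided moving-average (Wold) representation $$X_t=\sum_{j=0}^\infty\psi_jZ_{t-j}\quad(\text{convergence in }L^2),\qquad t\in\mathbb Z .$$ Here the $\psi_j$ are real with $\psi_0=1$, $\sum_j\psi_j^2<\infty$, and $\sum_{j\ge0}\psi_jz^j=h(z)/h(0)$ for $|z|<1$, where $$h(z)=\exp\Big\{\frac1{4\pi}\int_{-\pi}^{\pi}\frac{e^{i\lambda}+z}{e^{i\lambda}-z}\log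 f(\lambda)\,d\lambda\Big\};$$ $Z_t=X_t-\widehat X_t$ with $\widehat X_t$ the best linear predictor (in $L^2$) of $X_t$ from $\{X_s:s<t\}$; and the $Z_t$, $t\in\mathbb Z$, are i.i.d. Gaussian with mean zero and variance $$\sigma^2=2\pi\exp\Big\{\frac1{2\pi}\int_{-\pi}^{\pi}\log f(\lambda)\,d\lambda\Big\}.$$ -/

import Mathlib

open MeasureTheory ProbabilityTheory Filter
open scoped Topology

noncomputable section

namespace AggregatedAR

/-- A mixture density: a probability density on `[-1, 1]` with `∫ φ(x) / (1 - x²) dx < ∞`. -/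
structure IsMixtureDensity (φ : ℝ → ℝ) : Prop where
  measurable : Measurable φ
  nonneg : ∀ x, 0 ≤ φ x
  eq_zero : ∀ x, x ∉ Set.Icc (-1 : ℝ) 1 → φ x = 0
  integrable : IntegrableOn φ (Set.Icc (-1 : ℝ) 1)
  integral_eq_one : ∫ x in (-1 : ℝ)..1, φ x = 1
  integrable_div : IntegrableOn (fun x => φ x / (1 - x ^ 2)) (Set.Icc (-1 : ℝ) 1)

/-- The semiparametric form `φ(x) = (1 - x)^(1 - 2d) ψ(x)` with `0 < d < 1/2`, where `ψ` is a
nonnegative function supported in `[-1, 1]`, continuous at `1` (from inside `[-1, 1]`), and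
`ψ(1) ≠ 0`. -/
structure HasSemiparametricForm (φ ψ : ℝ → ℝ) (d : ℝ) : Prop where
  d_pos : 0 < d
  d_lt : d < 1 / 2
  form : ∀ x ∈ Set.Icc (-1 : ℝ) 1, φ x = (1 - x) ^ (1 - 2 * d) * ψ x
  nonneg : ∀ x, 0 ≤ ψ x
  support : tsupport ψ ⊆ Set.Icc (-1 : ℝ) 1
  continuous_one : ContinuousWithinAt ψ (Set.Icc (-1 : ℝ) 1) 1
  ne_zero_one : ψ 1 ≠ 0

/-- The support of `ψ` is `[-1, 1]`, and for some `0 < d' < 1/2` the function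
`ψ(x) (1 + x)^(2d' - 1)` extends continuously to `x = -1` with a nonzero value there. -/
def FullSupportCondition (ψ : ℝ → ℝ) : Prop :=
  tsupport ψ = Set.Icc (-1 : ℝ) 1 ∧
    ∃ d' : ℝ, 0 < d' ∧ d' < 1 / 2 ∧ ∃ c : ℝ, c ≠ 0 ∧
      Tendsto (fun x => ψ x * (1 + x) ^ (2 * d' - 1)) (𝓝[>] (-1 : ℝ)) (𝓝 c)

/-- The support of `ψ` is contained in `[-b, 1]` for some `0 < b < 1`. -/
def SeparatedSupportCondition (ψ : ℝ → ℝ) : Prop :=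
  ∃ b : ℝ, 0 < b ∧ b < 1 ∧ tsupport ψ ⊆ Set.Icc (-b) 1

/-- Strict stationarity of a process indexed by `ℤ`. -/
def IsStationary {Ω : Type*} [MeasurableSpace Ω] (P : Measure Ω) (Y : ℤ → Ω → ℝ) : Prop :=
  ∀ h : ℤ, IdentDistrib (fun ω (t : ℤ) => Y (t + h) ω) (fun ω (t : ℤ) => Y t ω) P P

/-- Independent stationary random-coefficient AR(1) processes
`Y j t = a j * Y j (t - 1) + ε j t`: the coefficients `a j` are i.i.d. with density `φ`, the noise
variables `ε j t` are i.i.d. with mean `0` and variance `v > 0`, and coefficients and noise are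
independent of each other. -/
structure IsRandomCoeffAR1 {Ω : Type*} [MeasurableSpace Ω] (P : Measure Ω)
    (φ : ℝ → ℝ) (v : ℝ) (a : ℕ → Ω → ℝ) (ε Y : ℕ → ℤ → Ω → ℝ) : Prop where
  measurable_coeff : ∀ j, Measurable (a j)
  measurable_noise : ∀ j t, Measurable (ε j t)
  measurable_process : ∀ j t, Measurable (Y j t)
  law_coeff : ∀ j, P.map (a j) = volume.withDensity (fun x => ENNReal.ofReal (φ x))
  identDistrib_noise : ∀ j t, IdentDistrib (ε j t) (ε 0 0) P P
  memLp_noise : ∀ j t, MemLp (ε j t) 2 P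
  mean_noise : ∀ j t, ∫ ω, ε j t ω ∂P = 0
  variance_noise : ∀ j t, ∫ ω, ε j t ω ^ 2 ∂P = v
  variance_pos : 0 < v
  -- joint independence of all the coefficients and all the noise variables
  indep : iIndepFun (Sum.elim a (fun p : ℕ × ℤ => ε p.1 p.2)) P
  recursion : ∀ j t, ∀ᵐ ω ∂P, Y j t ω = a j ω * Y j (t - 1) ω + ε j t ω
  stationary : ∀ j, IsStationary P (Y j)
  indep_process : iIndepFun (fun (j : ℕ) ω (t : ℤ) => Y j t ω) P

/-- The normalized sum `N^(-1/2) ∑_{j < N} Y j t`. -/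
def normalizedSum {Ω : Type*} (Y : ℕ → ℤ → Ω → ℝ) (N : ℕ) (t : ℤ) (ω : Ω) : ℝ :=
  (∑ j ∈ Finset.range N, Y j t ω) / Real.sqrt N

/-- `X` is the aggregated process of the sequence `Y`: its finite-dimensional distributions are the
weak limits of those of the normalized sums. -/
structure IsAggregatedProcess {Ω' : Type*} [MeasurableSpace Ω'] (P' : Measure Ω')
    [IsProbabilityMeasure P'] (Y : ℕ → ℤ → Ω' → ℝ)
    {Ω : Type*} [MeasurableSpace Ω] (P : Measure Ω) [IsProbabilityMeasure P]
    (X : ℤ → Ω → ℝ) : Prop where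
  measurable : ∀ t, Measurable (X t)
  tendsto_fdd : ∀ I : Finset ℤ,
    TendstoInDistribution (fun (N : ℕ) (ω : Ω') (t : I) => normalizedSum Y N t ω) atTop
      (fun (ω : Ω) (t : I) => X t ω) (fun _ => P') P

/-- The function `f(λ) = v / (2π) ∫_{-1}^{1} φ(x) / |1 - x e^{iλ}|² dx`. -/
def spectralDensity (φ : ℝ → ℝ) (v : ℝ) (l : ℝ) : ℝ :=
  v / (2 * Real.pi) *
    ∫ x in (-1 : ℝ)..1, φ x / ‖1 - (x : ℂ) * Complex.exp (Complex.I * l)‖ ^ 2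

/-- `f` is the spectral density on `[-π, π]` of the square-integrable process `X`. -/
structure HasSpectralDensity {Ω : Type*} [MeasurableSpace Ω] (P : Measure Ω) (X : ℤ → Ω → ℝ)
    (f : ℝ → ℝ) : Prop where
  memLp : ∀ t, MemLp (X t) 2 P
  nonneg : ∀ l, 0 ≤ f l
  integrable : IntervalIntegrable f volume (-Real.pi) Real.pi
  covariance_eq : ∀ t h : ℤ, ((covariance (X (t + h)) (X t) P : ℝ) : ℂ) =
    ∫ l in (-Real.pi)..Real.pi, Complex.exp (Complex.I * h * l) * (f l : ℂ)

/-- The outer function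
`h(z) = exp((4π)⁻¹ ∫_{-π}^{π} (e^{iλ} + z) / (e^{iλ} - z) log f(λ) dλ)`, for `|z| < 1`. -/
def outerFunction (f : ℝ → ℝ) (z : ℂ) : ℂ :=
  Complex.exp (1 / (4 * Real.pi) * ∫ l in (-Real.pi)..Real.pi,
    (Complex.exp (Complex.I * l) + z) / (Complex.exp (Complex.I * l) - z) * (Real.log (f l) : ℂ))

/-- `2π exp((2π)⁻¹ ∫_{-π}^{π} log f(λ) dλ)`. -/
def innovationVariance (f : ℝ → ℝ) : ℝ :=
  2 * Real.pi * Real.exp (1 / (2 * Real.pi) * ∫ l in (-Real.pi)..Real.pi, Real.log (f l))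

/-- `W` is the best linear predictor of `X t` from the past `X s`, `s < t`: it is an `L²`-limit of
finite linear combinations of the past, and no such combination has a smaller `L²`-error. -/
structure IsBestLinearPredictor {Ω : Type*} [MeasurableSpace Ω] (P : Measure Ω) (X : ℤ → Ω → ℝ)
    (t : ℤ) (W : Ω → ℝ) : Prop where
  memLp : MemLp W 2 P
  mem_closure : ∀ δ : ENNReal, 0 < δ → ∃ (S : Finset ℤ) (c : ℤ → ℝ), (∀ s ∈ S, s < t) ∧
    eLpNorm (fun ω => W ω - ∑ s ∈ S, c s * X s ω) 2 P < δ
  minimal : ∀ (S : Finset ℤ) (c : ℤ → ℝ), (∀ s ∈ S, s < t) →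
    eLpNorm (fun ω => X t ω - W ω) 2 P ≤ eLpNorm (fun ω => X t ω - ∑ s ∈ S, c s * X s ω) 2 P

/-- The one-sided moving-average (Wold) representation `X t = ∑_{j ≥ 0} c j * Z (t - j)`, the series
converging in `L²`, of a process with spectral density `f`: the `c j` are the Taylor coefficients of
`h(z) / h(0)` with `h` the outer function of `f`, `c 0 = 1`, `∑ (c j)² < ∞`, and the `Z t` are the
innovations `X t - (best linear predictor of X t)`. -/
structure IsWoldRepresentation {Ω : Type*} [MeasurableSpace Ω] (P : Measure Ω) (X : ℤ → Ω → ℝ)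
    (f : ℝ → ℝ) (c : ℕ → ℝ) (Z : ℤ → Ω → ℝ) : Prop where
  coeff_zero : c 0 = 1
  summable_sq : Summable (fun j => c j ^ 2)
  taylor : ∀ z : ℂ, ‖z‖ < 1 →
    HasSum (fun j : ℕ => (c j : ℂ) * z ^ j) (outerFunction f z / outerFunction f 0)
  innovation : ∀ t, IsBestLinearPredictor P X t (fun ω => X t ω - Z t ω)
  representation : ∀ t, Tendsto
    (fun n : ℕ => eLpNorm (fun ω => X t ω - ∑ j ∈ Finset.range n, c j * Z (t - j) ω) 2 P)
    atTop (𝓝 0)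

end AggregatedAR

end

namespace AggregatedAR

/-! Probabilistic half. Iterating the recursion writes `Y t` as `a ^ n * Y (t - n)` plus a partial
sum of `∑ a ^ k * e (t - k)`. The remainder tends to 0 in probability, because `Y (t - n)` has a
fixed law. The terms of the series are orthogonal, with summable squared norms because `1 / (1 - a ^
2)` is integrable, so the series converges in L² and its limit is `Y t` (`hasSum_toLp_term`). This
yields the covariances `autocov`, which Fubini identifies with the Fourier coefficients of `f`
(`integral_exp_mul_spectralDensity`). The central limit theorem, applied to each linear combination
of finitely many times, shows that every linear combination of the `X t` is centred Gaussian with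
these covariances (`IsAggregatedProcess.exists_map_sum_eq_gaussianReal`).

Analytic half. Only four properties of `f` enter: it is even, integrable, continuous where `sin`
does not vanish, and bounded below there by a positive constant. Hence `log f` is integrable, and
the outer function `h` satisfies `|h(r e^{il})|² = exp(P_r log f)(l)`, with `P_r` the Poisson
integral. Jensen's inequality and a Scheffé argument give `exp(P_r log f) → f` in L¹ as `r ↑ 1`. So
the Taylor coefficients `c` of `h / h(0)` are square summable, and `σ² ∑ c_k c_{k+h}` is the `h`-th
Fourier coefficient of `f` (`innovationVariance_mul_tsum`).

Conclusion. The vectors `x_t = ∑ c_j e_{t-j}` of ℓ²(ℤ), with `e_t` the standard basis, have the Gram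
matrix of `X` up to the factor `σ²`, so a scaled isometry `V` sends `x_t` to `X t`; put `Z t = V
e_t`. The crucial point is that `e_t - x_t` lies in the closed span of the past `x_s`, `s < t`
(`single_sub_maVector_mem`), which is proved with the Taylor coefficients of `h(0) / h`. It makes
the `x_t` span ℓ²(ℤ) and makes `Z t` the innovation. Gaussianity passes to L² limits through
characteristic functions, and orthogonality of the `e_t` becomes independence of the `Z t`. -/

theorem inner_toLp_eq_integral {Ω : Type*} [MeasurableSpace Ω] {P : Measure Ω} {f g : Ω → ℝ}
    (hf : MemLp f 2 P) (hg : MemLp g 2 P) :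
    inner ℝ (hf.toLp f) (hg.toLp g) = ∫ ω, f ω * g ω ∂P := by
  rw [L2.inner_def]
  refine integral_congr_ae ?_
  filter_upwards [hf.coeFn_toLp, hg.coeFn_toLp] with ω h1 h2
  rw [h1, h2]
  simp [mul_comm]

/-- Pythagoras turns the Cauchy criterion for the squared norms into the one for the vectors. -/
theorem summable_of_pairwise_orthogonal {H : Type*} [NormedAddCommGroup H] [InnerProductSpace ℝ H]
    [CompleteSpace H] {x : ℕ → H} (ho : Pairwise fun i j => inner ℝ (x i) (x j) = (0 : ℝ))
    (hs : Summable fun i => ‖x i‖ ^ 2) : Summable x := by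
  rw [summable_iff_vanishing_norm]
  intro δ hδ
  obtain ⟨s, hs⟩ := summable_iff_vanishing_norm.1 hs (δ ^ 2) (by positivity)
  refine ⟨s, fun t ht => ?_⟩
  have h := hs t ht
  have h2 : ‖∑ i ∈ t, x i‖ ^ 2 = ∑ i ∈ t, ‖x i‖ ^ 2 := by
    rw [← real_inner_self_eq_norm_sq, sum_inner]
    refine Finset.sum_congr rfl fun i hi => ?_
    rw [inner_sum, Finset.sum_eq_single i, real_inner_self_eq_norm_sq]
    · intro j _ hj
      exact ho hj.symm
    · exact fun h => absurd hi h
  rw [Real.norm_of_nonneg (by positivity), ← h2] at h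
  exact lt_of_pow_lt_pow_left₀ 2 hδ.le h

/-! ### One random-coefficient AR(1) process: L² expansion and second moments. -/

section SingleProcess

variable {Ω : Type*} [MeasurableSpace Ω] {P : Measure Ω}
  {a : Ω → ℝ} {e Y : ℤ → Ω → ℝ} {v : ℝ}

theorem memLp_pow_mul (ha : Measurable a) (h1 : ∀ᵐ ω ∂P, |a ω| < 1)
    {g : Ω → ℝ} {p : ENNReal} (hg : MemLp g p P) (k : ℕ) :
    MemLp (fun ω => a ω ^ k * g ω) p P := by
  refine hg.mono ((ha.pow_const k).aestronglyMeasurable.mul hg.1) ?_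
  filter_upwards [h1] with ω hω
  rw [norm_mul, norm_pow]
  exact mul_le_of_le_one_left (norm_nonneg _) (pow_le_one₀ (norm_nonneg _) hω.le)

/-- For `s = t` the factors `a ^ (k + l)` and `e s ^ 2` are independent; for `s ≠ t` the centred `e
t` is independent of everything else in the product. This is the orthogonality of the terms of the
AR(1) series. -/
theorem integral_pow_mul_pow_mul (ha : Measurable a) (he : ∀ t, Measurable (e t))
    (hmean : ∀ t, ∫ ω, e t ω ∂P = 0) (hvar : ∀ t, ∫ ω, e t ω ^ 2 ∂P = v)
    (hI1 : ∀ s, IndepFun a (e s) P)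
    (hI2 : ∀ s t, s ≠ t → IndepFun (fun ω => (a ω, e s ω)) (e t) P) (k l : ℕ) (s t : ℤ) :
    ∫ ω, (a ω ^ k * e s ω) * (a ω ^ l * e t ω) ∂P =
      if s = t then v * ∫ ω, a ω ^ (k + l) ∂P else 0 := by
  split_ifs with h
  · subst h
    have := ((hI1 s).comp (φ := fun x => x ^ (k + l)) (ψ := fun x => x ^ 2)
      (by fun_prop) (by fun_prop)).integral_fun_mul_eq_mul_integral
      (by exact ((ha.pow_const _).aestronglyMeasurable))
      (by exact (((he s).pow_const 2).aestronglyMeasurable))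
    simp only [Function.comp_apply, hvar] at this
    rw [mul_comm, ← this]
    congr 1; ext ω; ring
  · have := ((hI2 s t h).comp (φ := fun x : ℝ × ℝ => x.1 ^ (k + l) * x.2) (ψ := fun x => x)
      (by fun_prop) (by fun_prop)).integral_fun_mul_eq_mul_integral
      (by exact (((ha.pow_const _).mul (he s)).aestronglyMeasurable))
      (by exact ((he t).aestronglyMeasurable))
    simp only [Function.comp_apply, hmean, mul_zero] at this
    rw [← this]
    congr 1; ext ω; ring

/-- The geometric series with `h = 0` dominates all the others, and its sum `1 / (1 - a ^ 2)` is
integrable. -/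
theorem hasSum_integral_pow (ha : Measurable a) (h1 : ∀ᵐ ω ∂P, |a ω| < 1)
    (hint : Integrable (fun ω => 1 / (1 - a ω ^ 2)) P) (h : ℕ) :
    HasSum (fun l : ℕ => ∫ ω, a ω ^ (2 * l + h) ∂P) (∫ ω, a ω ^ h / (1 - a ω ^ 2) ∂P) := by
  have hgeo : ∀ᵐ ω ∂P, HasSum (fun l : ℕ => a ω ^ (2 * l + h)) (a ω ^ h / (1 - a ω ^ 2)) := by
    filter_upwards [h1] with ω hω
    have h3 : |a ω ^ 2| < 1 := by rw [abs_pow]; exact pow_lt_one₀ (abs_nonneg _) hω two_ne_zero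
    have := (hasSum_geometric_of_abs_lt_one h3).mul_left (a ω ^ h)
    rw [← div_eq_mul_inv] at this
    refine this.congr_fun ?_
    intro l; ring
  have hgeo' : ∀ᵐ ω ∂P, HasSum (fun l : ℕ => (a ω ^ 2) ^ l) (1 / (1 - a ω ^ 2)) := by
    filter_upwards [h1] with ω hω
    have h3 : |a ω ^ 2| < 1 := by rw [abs_pow]; exact pow_lt_one₀ (abs_nonneg _) hω two_ne_zero
    simpa using (hasSum_geometric_of_abs_lt_one h3)
  refine hasSum_integral_of_dominated_convergence (fun l ω => (a ω ^ 2) ^ l)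
    (fun l => (ha.pow_const _).aestronglyMeasurable) (fun l => ?_) ?_ ?_ hgeo
  · filter_upwards [h1] with ω hω
    rw [norm_pow, pow_add, pow_mul, Real.norm_eq_abs, sq_abs]
    exact mul_le_of_le_one_right (by positivity) (pow_le_one₀ (abs_nonneg _) hω.le)
  · filter_upwards [hgeo'] with ω hω using hω.summable
  · refine hint.congr ?_
    filter_upwards [hgeo'] with ω hω using hω.tsum_eq.symm

theorem ar_iterate (hrec : ∀ t, ∀ᵐ ω ∂P, Y t ω = a ω * Y (t - 1) ω + e t ω) (t : ℤ) (n : ℕ) :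
    ∀ᵐ ω ∂P, Y t ω = a ω ^ n * Y (t - n) ω + ∑ k ∈ Finset.range n, a ω ^ k * e (t - k) ω := by
  induction n with
  | zero => exact ae_of_all _ fun ω => by simp
  | succ n ih =>
    filter_upwards [ih, hrec (t - n)] with ω h1 h2
    rw [h1, h2, Finset.sum_range_succ, show t - (n : ℤ) - 1 = t - ((n + 1 : ℕ) : ℤ) by
      push_cast; ring]
    ring

variable [IsProbabilityMeasure P]

/-- A sequence tending to 0 almost surely times a tight sequence tends to 0 in probability.
Tightness comes from the common law of the `W n`, so no moments are needed. -/
theorem tendstoInMeasure_pow_mul (ha : Measurable a) (h1 : ∀ᵐ ω ∂P, |a ω| < 1)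
    {W : ℕ → Ω → ℝ} (hW : ∀ n, IdentDistrib (W n) (W 0) P P) :
    TendstoInMeasure P (fun n ω => a ω ^ n * W n ω) atTop (fun _ => 0) := by
  have hpow : TendstoInMeasure P (fun n ω => a ω ^ n) atTop (fun _ => 0) := by
    refine tendstoInMeasure_of_tendsto_ae (fun n => (ha.pow_const n).aestronglyMeasurable) ?_
    filter_upwards [h1] with ω hω using tendsto_pow_atTop_nhds_zero_of_abs_lt_one hω
  rw [tendstoInMeasure_iff_norm] at hpow ⊢
  intro δ hδ
  have htail : Tendsto (fun M : ℕ => P {ω | (M : ℝ) ≤ |W 0 ω|}) atTop (𝓝 0) := by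
    have h0 : (⋂ M : ℕ, {ω | (M : ℝ) ≤ |W 0 ω|}) = ∅ := by
      ext ω
      simp only [Set.mem_iInter, Set.mem_ofPred_eq, Set.mem_empty_iff_false, iff_false, not_forall,
        not_le]
      exact exists_nat_gt _
    have := tendsto_measure_iInter_atTop (μ := P) (s := fun M : ℕ => {ω | (M : ℝ) ≤ |W 0 ω|})
      (fun M => nullMeasurableSet_le aemeasurable_const (hW 0).aemeasurable_fst.abs)
      (fun m n hmn ω (hω : (n : ℝ) ≤ |W 0 ω|) =>
        show (m : ℝ) ≤ |W 0 ω| from le_trans (by exact_mod_cast hmn) hω) ⟨0, measure_ne_top _ _⟩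
    rwa [h0, measure_empty] at this
  rw [ENNReal.tendsto_atTop_zero]
  intro η hη
  obtain ⟨M, hM⟩ := ENNReal.tendsto_atTop_zero.1 htail (η / 2) (ENNReal.half_pos hη.ne')
  have hM1 := hM (M + 1) (by omega)
  -- With `|W n| < M + 1`, the product can reach `δ` only if `|a ^ n|` reaches `δ / (M + 1)`; using
  -- `M + 1` keeps the denominator positive.
  obtain ⟨N, hN⟩ := ENNReal.tendsto_atTop_zero.1 (hpow (δ / ((M + 1 : ℕ) : ℝ)) (by positivity))
    (η / 2) (ENNReal.half_pos hη.ne')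
  refine ⟨N, fun n hn => ?_⟩
  have hid : P {ω | ((M + 1 : ℕ) : ℝ) ≤ |W n ω|} = P {ω | ((M + 1 : ℕ) : ℝ) ≤ |W 0 ω|} :=
    (hW n).measure_mem_eq (s := {x : ℝ | ((M + 1 : ℕ) : ℝ) ≤ |x|})
      (measurableSet_le measurable_const (by fun_prop))
  calc P {ω | δ ≤ ‖a ω ^ n * W n ω - 0‖}
      ≤ P ({ω | δ / ((M + 1 : ℕ) : ℝ) ≤ ‖a ω ^ n - 0‖} ∪ {ω | ((M + 1 : ℕ) : ℝ) ≤ |W n ω|}) := by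
        refine measure_mono fun ω hω => ?_
        simp only [Set.mem_ofPred_eq, Set.mem_union, sub_zero, norm_mul] at hω ⊢
        by_contra! hc
        have hp : (0 : ℝ) < ((M + 1 : ℕ) : ℝ) := by positivity
        have := mul_lt_mul'' hc.1 hc.2 (norm_nonneg _) (abs_nonneg _)
        rw [div_mul_cancel₀ _ hp.ne'] at this
        exact absurd hω (not_le.2 this)
    _ ≤ η / 2 + η / 2 := (measure_union_le _ _).trans
        (add_le_add (hN n hn) (hid ▸ hM1))
    _ = η := ENNReal.add_halves η

/-- At every time the remainder has the same factor `a ^ n`, so the total remainder is `a ^ n` times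
a shifted linear combination, whose law does not depend on the shift. -/
theorem tendstoInMeasure_sum_partial_sum (ha : Measurable a) (h1 : ∀ᵐ ω ∂P, |a ω| < 1)
    (hrec : ∀ t, ∀ᵐ ω ∂P, Y t ω = a ω * Y (t - 1) ω + e t ω) (I : Finset ℤ) (c : ℤ → ℝ)
    (hst : ∀ h : ℤ, IdentDistrib (fun ω => ∑ t ∈ I, c t * Y (t + h) ω)
      (fun ω => ∑ t ∈ I, c t * Y t ω) P P) :
    TendstoInMeasure P
      (fun (n : ℕ) ω => ∑ t ∈ I, c t * ∑ k ∈ Finset.range n, a ω ^ k * e (t - k) ω) atTop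
      (fun ω => ∑ t ∈ I, c t * Y t ω) := by
  have h := tendstoInMeasure_pow_mul ha h1
    (W := fun (n : ℕ) ω => ∑ t ∈ I, c t * Y (t + -(n : ℤ)) ω)
    (fun n => (hst _).trans (hst _).symm)
  rw [tendstoInMeasure_iff_norm] at h ⊢
  intro δ hδ
  refine (h δ hδ).congr fun n => measure_congr ?_
  have hall : ∀ᵐ ω ∂P, ∀ t ∈ I, Y t ω =
      a ω ^ n * Y (t - n) ω + ∑ k ∈ Finset.range n, a ω ^ k * e (t - k) ω := by
    rw [Finset.eventually_all]
    exact fun t _ => ar_iterate hrec t n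
  filter_upwards [hall] with ω hω
  apply propext
  change δ ≤ ‖_‖ ↔ δ ≤ ‖_‖
  rw [sub_zero, ← norm_neg (_ - _), neg_sub, ← Finset.sum_sub_distrib, Finset.mul_sum]
  refine iff_of_eq ?_
  congr 2
  refine Finset.sum_congr rfl fun t ht => ?_
  rw [hω t ht, ← sub_eq_add_neg]
  ring

/-- Orthogonality gives an L² limit of the series, and the partial sums converge in probability to
`Y t`, so the two limits agree. Square integrability of `Y t` is thus a consequence of stationarity
and the recursion. -/
theorem hasSum_toLp_term (ha : Measurable a) (h1 : ∀ᵐ ω ∂P, |a ω| < 1)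
    (hint : Integrable (fun ω => 1 / (1 - a ω ^ 2)) P)
    (he : ∀ t, Measurable (e t)) (he2 : ∀ t, MemLp (e t) 2 P)
    (hmean : ∀ t, ∫ ω, e t ω ∂P = 0) (hvar : ∀ t, ∫ ω, e t ω ^ 2 ∂P = v)
    (hI1 : ∀ s, IndepFun a (e s) P)
    (hI2 : ∀ s t, s ≠ t → IndepFun (fun ω => (a ω, e s ω)) (e t) P)
    (hrec : ∀ t, ∀ᵐ ω ∂P, Y t ω = a ω * Y (t - 1) ω + e t ω)
    (hst : ∀ t, IdentDistrib (Y t) (Y 0) P P) (t : ℤ) :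
    ∃ hm : MemLp (Y t) 2 P,
      HasSum (fun k : ℕ => (memLp_pow_mul ha h1 (he2 (t - k)) k).toLp) (hm.toLp (Y t)) := by
  have hinner := integral_pow_mul_pow_mul ha he hmean hvar hI1 hI2
  have hsum : Summable (fun k : ℕ => (memLp_pow_mul ha h1 (he2 (t - k)) k).toLp) := by
    refine summable_of_pairwise_orthogonal ?_ ?_
    · intro i j hij
      rw [inner_toLp_eq_integral, hinner, if_neg]
      simpa using hij
    · refine ((hasSum_integral_pow ha h1 hint 0).summable.mul_left v).congr fun k => ?_
      rw [← real_inner_self_eq_norm_sq, inner_toLp_eq_integral, hinner, if_pos rfl, two_mul,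
        add_zero]
  obtain ⟨w, hw⟩ := hsum
  have hS : ∀ n : ℕ, MemLp (fun ω => ∑ k ∈ Finset.range n, a ω ^ k * e (t - k) ω) 2 P := fun n =>
    memLp_finsetSum _ fun k _ => memLp_pow_mul ha h1 (he2 (t - k)) k
  have hS' : ∀ n : ℕ, (hS n).toLp =
      ∑ k ∈ Finset.range n, (memLp_pow_mul ha h1 (he2 (t - k)) k).toLp := by
    intro n
    refine Lp.ext ?_
    refine (hS n).coeFn_toLp.trans ?_
    have : ∀ᵐ ω ∂P, ∀ k ∈ Finset.range n, ((memLp_pow_mul ha h1 (he2 (t - k)) k).toLp) ω =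
        a ω ^ k * e (t - k) ω := by
      rw [Finset.eventually_all]
      exact fun k _ => (memLp_pow_mul ha h1 (he2 (t - k)) k).coeFn_toLp
    filter_upwards [this, Lp.coeFn_finsetSum (Finset.range n)
      (fun k : ℕ => (memLp_pow_mul ha h1 (he2 (t - k)) k).toLp)] with ω h2 h3
    rw [h3, Finset.sum_apply]
    exact (Finset.sum_congr rfl fun k hk => h2 k hk).symm
  have hconv := hw.tendsto_sum_nat
  simp_rw [← hS'] at hconv
  have hm1 := tendstoInMeasure_of_tendsto_Lp hconv
  have hm2 : TendstoInMeasure P (fun n : ℕ => ((hS n).toLp : Ω → ℝ)) atTop (Y t) := by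
    have := tendstoInMeasure_sum_partial_sum ha h1 hrec {t} (fun _ => 1)
      (fun h => by simpa using (hst (t + h)).trans (hst t).symm)
    simp only [Finset.sum_singleton, one_mul] at this
    exact this.congr_left fun n => (hS n).coeFn_toLp.symm
  have hae : Y t =ᵐ[P] w := tendstoInMeasure_ae_unique hm2 hm1
  refine ⟨(memLp_congr_ae hae).2 (Lp.memLp w), ?_⟩
  convert hw
  exact Lp.ext ((MemLp.coeFn_toLp _).trans hae)

/-- Both factors are expanded in L², one at a time, and the surviving moments are summed as a
geometric series. -/
theorem integral_mul_of_hasSum (ha : Measurable a) (h1 : ∀ᵐ ω ∂P, |a ω| < 1)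
    (hint : Integrable (fun ω => 1 / (1 - a ω ^ 2)) P)
    (he : ∀ t, Measurable (e t)) (he2 : ∀ t, MemLp (e t) 2 P)
    (hmean : ∀ t, ∫ ω, e t ω ∂P = 0) (hvar : ∀ t, ∫ ω, e t ω ^ 2 ∂P = v)
    (hI1 : ∀ s, IndepFun a (e s) P)
    (hI2 : ∀ s t, s ≠ t → IndepFun (fun ω => (a ω, e s ω)) (e t) P)
    (hrec : ∀ t, ∀ᵐ ω ∂P, Y t ω = a ω * Y (t - 1) ω + e t ω)
    (hst : ∀ t, IdentDistrib (Y t) (Y 0) P P) (t : ℤ) (h : ℕ) :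
    ∫ ω, Y (t + h) ω * Y t ω ∂P = v * ∫ ω, a ω ^ h / (1 - a ω ^ 2) ∂P := by
  have hinner := integral_pow_mul_pow_mul ha he hmean hvar hI1 hI2
  obtain ⟨m1, hs1⟩ := hasSum_toLp_term ha h1 hint he he2 hmean hvar hI1 hI2 hrec hst (t + h)
  obtain ⟨m2, hs2⟩ := hasSum_toLp_term ha h1 hint he he2 hmean hvar hI1 hI2 hrec hst t
  rw [← inner_toLp_eq_integral m1 m2]
  have hA : HasSum (fun l : ℕ => inner ℝ (m1.toLp) (memLp_pow_mul ha h1 (he2 (t - l)) l).toLp)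
      (inner ℝ m1.toLp m2.toLp) := by
    simpa using (innerSL ℝ m1.toLp).hasSum hs2
  refine hA.unique ?_
  refine ((hasSum_integral_pow ha h1 hint h).mul_left v).congr_fun fun l => ?_
  have hB : HasSum (fun k : ℕ => inner ℝ (memLp_pow_mul ha h1 (he2 (t - l)) l).toLp
      (memLp_pow_mul ha h1 (he2 (t + h - k)) k).toLp)
      (inner ℝ (memLp_pow_mul ha h1 (he2 (t - l)) l).toLp m1.toLp) := by
    simpa using (innerSL ℝ (memLp_pow_mul ha h1 (he2 (t - l)) l).toLp).hasSum hs1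
  rw [real_inner_comm]
  refine hB.unique ?_
  -- The noise times `t - l` and `t + h - k` coincide only for `k = l + h`.
  have hC := hasSum_single (l + h) (f := fun k : ℕ =>
    inner ℝ (memLp_pow_mul ha h1 (he2 (t - l)) l).toLp
      (memLp_pow_mul ha h1 (he2 (t + h - k)) k).toLp) (fun k hk => by
        rw [inner_toLp_eq_integral, hinner, if_neg]
        intro h
        apply hk
        omega)
  convert hC using 1
  rw [inner_toLp_eq_integral, hinner, if_pos (by push_cast; ring)]
  congr 2; ext ω; ring_nf

/-- The expectation is the inner product with the constant 1, and each term of the series is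
centred. -/
theorem integral_eq_zero_of_hasSum (ha : Measurable a) (h1 : ∀ᵐ ω ∂P, |a ω| < 1)
    (hint : Integrable (fun ω => 1 / (1 - a ω ^ 2)) P)
    (he : ∀ t, Measurable (e t)) (he2 : ∀ t, MemLp (e t) 2 P)
    (hmean : ∀ t, ∫ ω, e t ω ∂P = 0) (hvar : ∀ t, ∫ ω, e t ω ^ 2 ∂P = v)
    (hI1 : ∀ s, IndepFun a (e s) P)
    (hI2 : ∀ s t, s ≠ t → IndepFun (fun ω => (a ω, e s ω)) (e t) P)
    (hrec : ∀ t, ∀ᵐ ω ∂P, Y t ω = a ω * Y (t - 1) ω + e t ω)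
    (hst : ∀ t, IdentDistrib (Y t) (Y 0) P P) (t : ℤ) :
    ∫ ω, Y t ω ∂P = 0 := by
  obtain ⟨m, hs⟩ := hasSum_toLp_term ha h1 hint he he2 hmean hvar hI1 hI2 hrec hst t
  have hc : MemLp (fun _ : Ω => (1 : ℝ)) 2 P := memLp_const 1
  have hA : HasSum (fun l : ℕ => inner ℝ hc.toLp (memLp_pow_mul ha h1 (he2 (t - l)) l).toLp)
      (inner ℝ hc.toLp m.toLp) := by
    simpa using (innerSL ℝ hc.toLp).hasSum hs
  have hz : ∀ l : ℕ, inner ℝ hc.toLp (memLp_pow_mul ha h1 (he2 (t - l)) l).toLp = (0 : ℝ) := by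
    intro l
    rw [inner_toLp_eq_integral]
    have := ((hI1 (t - l)).comp (φ := fun x => x ^ l) (ψ := fun x => x)
      (by fun_prop) (by fun_prop)).integral_fun_mul_eq_mul_integral
      (by exact ((ha.pow_const _).aestronglyMeasurable))
      (by exact ((he _).aestronglyMeasurable))
    simp only [Function.comp_apply, hmean, mul_zero] at this
    simpa using this
  simp_rw [hz] at hA
  have := hA.unique hasSum_zero
  rw [inner_toLp_eq_integral] at this
  simpa using this

end SingleProcess

/-- The autocovariance `v ∫_{-1}^{1} φ(x) x^{|h|} / (1 - x²) dx` of the AR(1) mixture. -/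
noncomputable def autocov (φ : ℝ → ℝ) (v : ℝ) (h : ℤ) : ℝ :=
  v * ∫ x in (-1 : ℝ)..1, φ x * (x ^ h.natAbs / (1 - x ^ 2))

/-! ### From the law of the coefficient to integrals against `φ`. -/

section Mixture

variable {Ω : Type*} [MeasurableSpace Ω] {P : Measure Ω}
  {φ : ℝ → ℝ} {a : Ω → ℝ}

/-- The density vanishes outside `[-1, 1]`, and the endpoints are Lebesgue null. -/
theorem ae_abs_lt_one_of_law (hφ : IsMixtureDensity φ) (ha : Measurable a)
    (hlaw : P.map a = volume.withDensity (fun x => ENNReal.ofReal (φ x))) :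
    ∀ᵐ ω ∂P, |a ω| < 1 := by
  have hs : MeasurableSet {x : ℝ | |x| < 1} := measurableSet_lt (by fun_prop) measurable_const
  have : ∀ᵐ x ∂(P.map a), |x| < 1 := by
    rw [hlaw, ae_withDensity_iff hφ.measurable.ennreal_ofReal]
    have h1 : ∀ᵐ x : ℝ, x ≠ 1 := by simp [ae_iff, measure_singleton]
    have h2 : ∀ᵐ x : ℝ, x ≠ -1 := by simp [ae_iff, measure_singleton]
    filter_upwards [h1, h2] with x hx1 hx2 hne
    by_contra hc
    apply hne
    rw [hφ.eq_zero x, ENNReal.ofReal_zero]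
    rintro ⟨h3, h4⟩
    exact hc (abs_lt.2 ⟨lt_of_le_of_ne h3 hx2.symm, lt_of_le_of_ne h4 hx1⟩)
  exact (ae_map_iff ha.aemeasurable hs).1 this

theorem integral_comp_of_law (hφ : IsMixtureDensity φ) (ha : Measurable a)
    (hlaw : P.map a = volume.withDensity (fun x => ENNReal.ofReal (φ x)))
    {g : ℝ → ℝ} (hg : Measurable g) :
    ∫ ω, g (a ω) ∂P = ∫ x in (-1 : ℝ)..1, φ x * g x := by
  rw [← integral_map (f := g) ha.aemeasurable hg.aestronglyMeasurable, hlaw,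
    integral_withDensity_eq_integral_toReal_smul hφ.measurable.ennreal_ofReal
      (ae_of_all _ fun x => ENNReal.ofReal_lt_top),
    intervalIntegral.integral_of_le (by norm_num), ← integral_Icc_eq_integral_Ioc,
    ← setIntegral_eq_integral_of_forall_compl_eq_zero (s := Set.Icc (-1 : ℝ) 1)]
  · simp only [ENNReal.toReal_ofReal (hφ.nonneg _), smul_eq_mul]
  · intro x hx
    simp [hφ.eq_zero x hx]

theorem integrable_comp_of_law (hφ : IsMixtureDensity φ) (ha : Measurable a)
    (hlaw : P.map a = volume.withDensity (fun x => ENNReal.ofReal (φ x))) :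
    Integrable (fun ω => 1 / (1 - a ω ^ 2)) P := by
  have hg : Measurable fun x : ℝ => 1 / (1 - x ^ 2) := by fun_prop
  have : Integrable (fun x : ℝ => 1 / (1 - x ^ 2)) (P.map a) := by
    rw [hlaw, integrable_withDensity_iff hφ.measurable.ennreal_ofReal
      (ae_of_all _ fun x => ENNReal.ofReal_lt_top)]
    simp only [ENNReal.toReal_ofReal (hφ.nonneg _)]
    have h := hφ.integrable_div.integrable_indicator measurableSet_Icc
    refine h.congr (ae_of_all _ fun x => ?_)
    by_cases hx : x ∈ Set.Icc (-1 : ℝ) 1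
    · simp only [Set.indicator_of_mem hx]; ring
    · simp only [Set.indicator_of_notMem hx, hφ.eq_zero x hx]; ring
  exact this.comp_measurable ha

end Mixture

/-! ### The sequence of independent copies. -/

section RandomCoeff

variable {Ω : Type*} [MeasurableSpace Ω] {P : Measure Ω}
  {φ : ℝ → ℝ} {v : ℝ} {a : ℕ → Ω → ℝ} {ε Y : ℕ → ℤ → Ω → ℝ}

namespace IsRandomCoeffAR1

theorem indepFun_coeff_noise (hY : IsRandomCoeffAR1 P φ v a ε Y) (j : ℕ) (s : ℤ) :
    IndepFun (a j) (ε j s) P :=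
  hY.indep.indepFun (i := Sum.inl j) (j := Sum.inr (j, s)) (by simp)

theorem indepFun_coeff_noise_noise (hY : IsRandomCoeffAR1 P φ v a ε Y) (j : ℕ) (s t : ℤ)
    (hst : s ≠ t) : IndepFun (fun ω => (a j ω, ε j s ω)) (ε j t) P := by
  refine hY.indep.indepFun_prodMk ?_ (Sum.inl j) (Sum.inr (j, s)) (Sum.inr (j, t)) (by simp)
    (by simpa using hst)
  rintro (i | p)
  · exact hY.measurable_coeff i
  · exact hY.measurable_noise p.1 p.2

theorem identDistrib_process (hY : IsRandomCoeffAR1 P φ v a ε Y) (j : ℕ) (t : ℤ) :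
    IdentDistrib (Y j t) (Y j 0) P P := by
  have := (hY.stationary j t).comp (measurable_pi_apply (0 : ℤ))
  simpa [Function.comp_def] using this

variable [IsProbabilityMeasure P]

theorem memLp_process (hφ : IsMixtureDensity φ) (hY : IsRandomCoeffAR1 P φ v a ε Y) (j : ℕ)
    (t : ℤ) : MemLp (Y j t) 2 P :=
  (hasSum_toLp_term (hY.measurable_coeff j)
    (ae_abs_lt_one_of_law hφ (hY.measurable_coeff j) (hY.law_coeff j))
    (integrable_comp_of_law hφ (hY.measurable_coeff j) (hY.law_coeff j)) (hY.measurable_noise j)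
    (hY.memLp_noise j) (hY.mean_noise j) (hY.variance_noise j) (hY.indepFun_coeff_noise j)
    (hY.indepFun_coeff_noise_noise j) (hY.recursion j) (hY.identDistrib_process j) t).1

theorem integral_process (hφ : IsMixtureDensity φ) (hY : IsRandomCoeffAR1 P φ v a ε Y) (j : ℕ)
    (t : ℤ) : ∫ ω, Y j t ω ∂P = 0 :=
  integral_eq_zero_of_hasSum (hY.measurable_coeff j)
    (ae_abs_lt_one_of_law hφ (hY.measurable_coeff j) (hY.law_coeff j))
    (integrable_comp_of_law hφ (hY.measurable_coeff j) (hY.law_coeff j)) (hY.measurable_noise j)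
    (hY.memLp_noise j) (hY.mean_noise j) (hY.variance_noise j) (hY.indepFun_coeff_noise j)
    (hY.indepFun_coeff_noise_noise j) (hY.recursion j) (hY.identDistrib_process j) t

theorem integral_process_mul (hφ : IsMixtureDensity φ) (hY : IsRandomCoeffAR1 P φ v a ε Y)
    (j : ℕ) (s t : ℤ) : ∫ ω, Y j s ω * Y j t ω ∂P = autocov φ v (s - t) := by
  have key : ∀ (t : ℤ) (h : ℕ), ∫ ω, Y j (t + h) ω * Y j t ω ∂P = autocov φ v h := by
    intro t h
    rw [integral_mul_of_hasSum (hY.measurable_coeff j)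
      (ae_abs_lt_one_of_law hφ (hY.measurable_coeff j) (hY.law_coeff j))
      (integrable_comp_of_law hφ (hY.measurable_coeff j) (hY.law_coeff j)) (hY.measurable_noise j)
      (hY.memLp_noise j) (hY.mean_noise j) (hY.variance_noise j) (hY.indepFun_coeff_noise j)
      (hY.indepFun_coeff_noise_noise j) (hY.recursion j) (hY.identDistrib_process j) t h,
      integral_comp_of_law hφ (hY.measurable_coeff j) (hY.law_coeff j)
        (g := fun x => x ^ h / (1 - x ^ 2)) (by fun_prop)]
    rfl
  rcases le_total t s with h | h
  · obtain ⟨n, rfl⟩ := Int.le.dest h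
    rw [key, add_sub_cancel_left]
  · obtain ⟨n, rfl⟩ := Int.le.dest h
    rw [show s - (s + (n : ℤ)) = -(n : ℤ) by ring]
    simp_rw [mul_comm (Y j s _)]
    rw [key, autocov, autocov, Int.natAbs_neg]

/-- The central limit theorem needs identically distributed summands, whereas only the laws of
coefficients and noise are given to agree across `j`. The partial sums are the same functional of
`(a j, ε j)` for every `j`, hence equal in law, and limits in distribution are unique. -/
theorem identDistrib_sum (hφ : IsMixtureDensity φ) (hY : IsRandomCoeffAR1 P φ v a ε Y)
    (I : Finset ℤ) (c : ℤ → ℝ) (j : ℕ) :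
    IdentDistrib (fun ω => ∑ t ∈ I, c t * Y j t ω) (fun ω => ∑ t ∈ I, c t * Y 0 t ω) P P := by
  -- the coefficient and the noise of one process, as one family
  let F : ℕ → Option ℤ → Ω → ℝ := fun j o => o.elim (a j) (ε j)
  have hF : ∀ j, iIndepFun (F j) P := by
    intro j
    have := hY.indep.precomp (g := fun o : Option ℤ => o.elim (Sum.inl j) fun t => Sum.inr (j, t))
      (by rintro (_ | x) (_ | y) h <;> simp_all)
    convert this using 1
    funext o
    cases o <;> rfl
  have hid : IdentDistrib (fun ω => (F j · ω)) (fun ω => (F 0 · ω)) P P := by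
    refine IdentDistrib.pi ?_ (hF j) (hF 0)
    rintro (_ | t)
    · exact ⟨(hY.measurable_coeff j).aemeasurable, (hY.measurable_coeff 0).aemeasurable,
        (hY.law_coeff j).trans (hY.law_coeff 0).symm⟩
    · exact (hY.identDistrib_noise j t).trans (hY.identDistrib_noise 0 t).symm
  have hlim : ∀ j, TendstoInDistribution
      (fun (n : ℕ) ω => ∑ t ∈ I, c t * ∑ k ∈ Finset.range n, a j ω ^ k * ε j (t - k) ω) atTop
      (fun ω => ∑ t ∈ I, c t * Y j t ω) (fun _ => P) P := by
    intro j
    have hm : ∀ n : ℕ, Measurable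
        fun ω => ∑ t ∈ I, c t * ∑ k ∈ Finset.range n, a j ω ^ k * ε j (t - k) ω := by
      intro n
      have := hY.measurable_coeff j
      have := hY.measurable_noise j
      fun_prop
    have hm' : Measurable fun ω => ∑ t ∈ I, c t * Y j t ω := by
      have := hY.measurable_process j
      fun_prop
    refine TendstoInMeasure.tendstoInDistribution ?_ (fun n => (hm n).aemeasurable)
    refine tendstoInMeasure_sum_partial_sum (hY.measurable_coeff j)
      (ae_abs_lt_one_of_law hφ (hY.measurable_coeff j) (hY.law_coeff j)) (hY.recursion j) I c ?_
    intro h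
    exact (hY.stationary j h).comp (u := fun y : ℤ → ℝ => ∑ t ∈ I, c t * y t) (by fun_prop)
  have hS : ∀ n : ℕ, IdentDistrib
      (fun ω => ∑ t ∈ I, c t * ∑ k ∈ Finset.range n, a j ω ^ k * ε j (t - k) ω)
      (fun ω => ∑ t ∈ I, c t * ∑ k ∈ Finset.range n, a 0 ω ^ k * ε 0 (t - k) ω) P P := fun n =>
    hid.comp (u := fun y : Option ℤ → ℝ =>
      ∑ t ∈ I, c t * ∑ k ∈ Finset.range n, y none ^ k * y (some (t - k))) (by fun_prop)
  refine ⟨(hlim j).aemeasurable_limit, (hlim 0).aemeasurable_limit, ?_⟩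
  refine tendstoInDistribution_unique _ (hlim j)
    (W := fun ω => ∑ t ∈ I, c t * Y 0 t ω) ⟨(hlim j).forall_aemeasurable, ?_, ?_⟩
  · exact (hlim 0).aemeasurable_limit
  · refine (hlim 0).tendsto.congr fun n => ?_
    exact Subtype.ext (hS n).map_eq.symm

theorem integral_sum_sq (hφ : IsMixtureDensity φ) (hY : IsRandomCoeffAR1 P φ v a ε Y)
    (I : Finset ℤ) (c : ℤ → ℝ) (j : ℕ) :
    ∫ ω, (∑ t ∈ I, c t * Y j t ω) ^ 2 ∂P =
      ∑ s ∈ I, ∑ t ∈ I, c s * c t * autocov φ v (s - t) := by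
  have hm := memLp_process hφ hY j
  have hint : ∀ s t, Integrable (fun ω => c s * c t * (Y j s ω * Y j t ω)) P := fun s t =>
    ((hm s).integrable_mul (hm t)).const_mul _
  have : ∀ ω, (∑ t ∈ I, c t * Y j t ω) ^ 2 =
      ∑ s ∈ I, ∑ t ∈ I, c s * c t * (Y j s ω * Y j t ω) := by
    intro ω
    rw [sq, Finset.sum_mul_sum]
    refine Finset.sum_congr rfl fun s _ => Finset.sum_congr rfl fun t _ => by ring
  simp_rw [this]
  rw [integral_finsetSum _ fun s _ => integrable_finsetSum _ fun t _ => hint s t]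
  refine Finset.sum_congr rfl fun s _ => ?_
  rw [integral_finsetSum _ fun t _ => hint s t]
  refine Finset.sum_congr rfl fun t _ => ?_
  rw [integral_const_mul, integral_process_mul hφ hY]

end IsRandomCoeffAR1

end RandomCoeff

/-! ### The aggregated process is Gaussian. -/

section Aggregated

variable {Ω' : Type*} [MeasurableSpace Ω'] {P' : Measure Ω'} [IsProbabilityMeasure P']
  {φ : ℝ → ℝ} {v : ℝ} {a : ℕ → Ω' → ℝ} {ε Y : ℕ → ℤ → Ω' → ℝ}
  {Ω : Type*} [MeasurableSpace Ω] {P : Measure Ω} [IsProbabilityMeasure P] {X : ℤ → Ω → ℝ}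

/-- A fixed linear functional of the normalized sums is a normalized sum of i.i.d. centred L²
variables. The central limit theorem and uniqueness of weak limits give its limiting law. -/
theorem IsAggregatedProcess.exists_map_sum_eq_gaussianReal (hφ : IsMixtureDensity φ)
    (hY : IsRandomCoeffAR1 P' φ v a ε Y) (hX : IsAggregatedProcess P' Y P X)
    (I : Finset ℤ) (c : ℤ → ℝ) :
    ∃ V : NNReal, (V : ℝ) = ∑ s ∈ I, ∑ t ∈ I, c s * c t * autocov φ v (s - t) ∧
      P.map (fun ω => ∑ t ∈ I, c t * X t ω) = gaussianReal 0 V := by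
  set L : ℕ → Ω' → ℝ := fun j ω => ∑ t ∈ I, c t * Y j t ω with hL
  have hLm : MemLp (L 0) 2 P' := memLp_finsetSum _ fun t _ => (hY.memLp_process hφ 0 t).const_mul _
  have hL0 : ∫ ω, L 0 ω ∂P' = 0 := by
    rw [integral_finsetSum _ fun t _ =>
      ((hY.memLp_process hφ 0 t).const_mul _).integrable one_le_two]
    simp [integral_const_mul, hY.integral_process hφ]
  have hvar : Var[L 0; P'] = ∑ s ∈ I, ∑ t ∈ I, c s * c t * autocov φ v (s - t) := by
    rw [variance_of_integral_eq_zero hLm.1.aemeasurable hL0, hY.integral_sum_sq hφ]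
  refine ⟨Var[L 0; P'].toNNReal, ?_, ?_⟩
  · rw [Real.coe_toNNReal _ (variance_nonneg _ _), hvar]
  have hclt := tendstoInDistribution_inv_sqrt_mul_sum_sub (P := P') (X := L) (Y := id)
    (P' := gaussianReal 0 Var[L 0; P'].toNNReal) ⟨aemeasurable_id, Measure.map_id⟩ hLm
    (hY.indep_process.comp (fun _ (y : ℤ → ℝ) => ∑ t ∈ I, c t * y t) (fun _ => by fun_prop))
    (hY.identDistrib_sum hφ I c)
  have hagg := (hX.tendsto_fdd I).continuous_comp
    (g := fun x : I → ℝ => ∑ t : I, c t * x t) (by fun_prop)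
  have hn : ∀ n : ℕ, ((fun x : I → ℝ => ∑ t : I, c t * x t) ∘
      fun (ω : Ω') (t : I) => normalizedSum Y n t ω) =
      fun ω => (Real.sqrt n)⁻¹ * (∑ k ∈ Finset.range n, L k ω - n * ∫ ω, L 0 ω ∂P') := by
    intro n
    ext ω
    rw [hL0]
    simp only [Function.comp_apply, mul_zero, sub_zero, normalizedSum, hL]
    rw [Finset.sum_coe_sort I (fun t => c t * ((∑ j ∈ Finset.range n, Y j t ω) / Real.sqrt n)),
      Finset.sum_comm, Finset.mul_sum]
    refine Finset.sum_congr rfl fun t _ => ?_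
    rw [← Finset.mul_sum]; ring
  simp_rw [hn] at hagg
  have := tendstoInDistribution_unique _ hagg hclt
  rw [Measure.map_id] at this
  rw [← this]
  congr 1
  ext ω
  exact (Finset.sum_coe_sort I (fun t => c t * X t ω)).symm

theorem IsAggregatedProcess.map_eq_gaussianReal (hφ : IsMixtureDensity φ)
    (hY : IsRandomCoeffAR1 P' φ v a ε Y) (hX : IsAggregatedProcess P' Y P X) (t : ℤ) :
    ∃ V : NNReal, P.map (X t) = gaussianReal 0 V := by
  obtain ⟨V, -, h⟩ := hX.exists_map_sum_eq_gaussianReal hφ hY {t} (fun _ => 1)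
  exact ⟨V, by simpa using h⟩

theorem IsAggregatedProcess.memLp (hφ : IsMixtureDensity φ)
    (hY : IsRandomCoeffAR1 P' φ v a ε Y) (hX : IsAggregatedProcess P' Y P X) (t : ℤ) :
    MemLp (X t) 2 P := by
  obtain ⟨V, h⟩ := hX.map_eq_gaussianReal hφ hY t
  have := memLp_id_gaussianReal (μ := 0) (v := V) 2
  rw [← h] at this
  exact this.comp_of_map (hX.measurable t).aemeasurable

theorem IsAggregatedProcess.integral_eq_zero (hφ : IsMixtureDensity φ)
    (hY : IsRandomCoeffAR1 P' φ v a ε Y) (hX : IsAggregatedProcess P' Y P X) (t : ℤ) :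
    ∫ ω, X t ω ∂P = 0 := by
  obtain ⟨V, h⟩ := hX.map_eq_gaussianReal hφ hY t
  have := integral_id_gaussianReal (μ := 0) (v := V)
  rw [← h, integral_map (hX.measurable t).aemeasurable (by fun_prop)] at this
  exact this

theorem IsAggregatedProcess.integral_sum_sq (hφ : IsMixtureDensity φ)
    (hY : IsRandomCoeffAR1 P' φ v a ε Y) (hX : IsAggregatedProcess P' Y P X)
    (I : Finset ℤ) (c : ℤ → ℝ) : ∫ ω, (∑ t ∈ I, c t * X t ω) ^ 2 ∂P =
      ∑ s ∈ I, ∑ t ∈ I, c s * c t * autocov φ v (s - t) := by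
  obtain ⟨V, hV, h⟩ := hX.exists_map_sum_eq_gaussianReal hφ hY I c
  have hm : Measurable fun ω => ∑ t ∈ I, c t * X t ω := by
    have := hX.measurable
    fun_prop
  have h1 := variance_id_gaussianReal (μ := 0) (v := V)
  rw [← h, variance_of_integral_eq_zero (by fun_prop) (by rw [h]; exact integral_id_gaussianReal),
    integral_map hm.aemeasurable (by fun_prop)] at h1
  rw [← hV, ← h1]
  rfl

/-- Polarization: the variances of `X s`, `X t` and `X s + X t` are known. -/
theorem IsAggregatedProcess.integral_mul (hφ : IsMixtureDensity φ)
    (hY : IsRandomCoeffAR1 P' φ v a ε Y) (hX : IsAggregatedProcess P' Y P X) (s t : ℤ) :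
    ∫ ω, X s ω * X t ω ∂P = autocov φ v (s - t) := by
  have hm := hX.memLp hφ hY
  have hsq : ∀ t, ∫ ω, X t ω ^ 2 ∂P = autocov φ v 0 := fun t => by
    simpa using hX.integral_sum_sq hφ hY {t} fun _ => 1
  rcases eq_or_ne s t with rfl | hst
  · simpa [sq] using hsq s
  · have h := hX.integral_sum_sq hφ hY {s, t} fun _ => 1
    simp only [Finset.sum_pair hst, one_mul, sub_self] at h
    have hx : ∀ ω, (X s ω + X t ω) ^ 2 = X s ω ^ 2 + X t ω ^ 2 + 2 * (X s ω * X t ω) := by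
      intro ω; ring
    simp_rw [hx] at h
    have hneg : autocov φ v (t - s) = autocov φ v (s - t) := by
      rw [autocov, autocov, ← Int.natAbs_neg, neg_sub]
    have hst2 : Integrable (fun ω => X s ω * X t ω) P := (hm s).integrable_mul (hm t)
    have hadd : Integrable (fun ω => X s ω ^ 2 + X t ω ^ 2) P :=
      (hm s).integrable_sq.add (hm t).integrable_sq
    rw [integral_add hadd (hst2.const_mul 2), integral_add (hm s).integrable_sq
      (hm t).integrable_sq, integral_const_mul, hsq, hsq, hneg] at h
    linarith

theorem IsAggregatedProcess.covariance_eq (hφ : IsMixtureDensity φ)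
    (hY : IsRandomCoeffAR1 P' φ v a ε Y) (hX : IsAggregatedProcess P' Y P X) (s t : ℤ) :
    covariance (X s) (X t) P = autocov φ v (s - t) := by
  rw [covariance_eq_sub (hX.memLp hφ hY s) (hX.memLp hφ hY t), hX.integral_eq_zero hφ hY s,
    zero_mul, sub_zero]
  exact hX.integral_mul hφ hY s t

/-- Gaussianity in the form that is stable under L² limits. -/
theorem IsAggregatedProcess.integral_exp_sum (hφ : IsMixtureDensity φ)
    (hY : IsRandomCoeffAR1 P' φ v a ε Y) (hX : IsAggregatedProcess P' Y P X)
    (I : Finset ℤ) (c : ℤ → ℝ) :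
    ∫ ω, Complex.exp (Complex.I * ((∑ t ∈ I, c t * X t ω : ℝ) : ℂ)) ∂P =
      Complex.exp (-((∫ ω, (∑ t ∈ I, c t * X t ω) ^ 2 ∂P : ℝ) : ℂ) / 2) := by
  obtain ⟨V, hV, h⟩ := hX.exists_map_sum_eq_gaussianReal hφ hY I c
  have hm : Measurable fun ω => ∑ t ∈ I, c t * X t ω := by
    have := hX.measurable
    fun_prop
  have h1 := charFun_gaussianReal (μ := 0) (v := V) 1
  rw [← h, charFun_apply_real, integral_map hm.aemeasurable (by fun_prop)] at h1
  rw [hX.integral_sum_sq hφ hY, ← hV]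
  refine Eq.trans ?_ (h1.trans ?_)
  · congr 1; ext ω; congr 1; push_cast; ring
  · congr 1; push_cast; ring

end Aggregated

/-! ### Fourier coefficients on the circle. -/

theorem norm_exp_I_mul (l : ℝ) : ‖Complex.exp (Complex.I * l)‖ = 1 := by
  rw [mul_comm, Complex.norm_exp_ofReal_mul_I]

theorem integral_exp_int_mul (n : ℤ) :
    ∫ l in (-Real.pi)..Real.pi, Complex.exp (Complex.I * n * l) =
      if n = 0 then 2 * (Real.pi : ℂ) else 0 := by
  split_ifs with h
  · subst h
    simp
    ring
  · have hc : Complex.I * n ≠ 0 := by simp [h]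
    rw [integral_exp_mul_complex hc]
    have : Complex.exp (Complex.I * n * (Real.pi : ℝ)) =
        Complex.exp (Complex.I * n * ((-Real.pi : ℝ) : ℂ)) := by
      rw [Complex.exp_eq_exp_iff_exists_int]
      refine ⟨n, ?_⟩
      push_cast; ring
    rw [this, sub_self, zero_div]

theorem hasSum_mul_of_summable_norm {x y : ℕ → ℂ} {s t : ℂ} (hx : HasSum x s) (hy : HasSum y t)
    (hx' : Summable fun k => ‖x k‖) (hy' : Summable fun k => ‖y k‖) :
    HasSum (fun p : ℕ × ℕ => x p.1 * y p.2) (s * t) :=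
  hx.mul hy (summable_mul_of_summable_norm hx' hy')

/-- A form of Parseval's identity: `‖A‖ ^ 2` is an absolutely convergent double series, integrated
term by term. -/
theorem integral_exp_mul_norm_sq_of_hasSum {a : ℕ → ℝ} {A : ℝ → ℂ} (ha : Summable fun k => |a k|)
    (hA : ∀ l : ℝ, HasSum (fun k : ℕ => (a k : ℂ) * Complex.exp (Complex.I * l) ^ k) (A l))
    (h : ℕ) :
    ∫ l in (-Real.pi)..Real.pi, Complex.exp (Complex.I * h * l) * ((‖A l‖ ^ 2 : ℝ) : ℂ) =
      2 * Real.pi * ((∑' k, a k * a (k + h) : ℝ) : ℂ) := by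
  set F : ℕ × ℕ → ℝ → ℂ := fun p l =>
    ((a p.1 * a p.2 : ℝ) : ℂ) * Complex.exp (Complex.I * ((h + p.1 - p.2 : ℤ) : ℂ) * l) with hF
  have hprod : Summable fun p : ℕ × ℕ => |a p.1 * a p.2| := by
    simp_rw [abs_mul]
    exact ha.mul_of_nonneg ha (fun _ => abs_nonneg _) (fun _ => abs_nonneg _)
  have hpt : ∀ l : ℝ, HasSum (fun p => F p l)
      (Complex.exp (Complex.I * h * l) * ((‖A l‖ ^ 2 : ℝ) : ℂ)) := by
    intro l
    have hn : Summable fun k : ℕ => ‖(a k : ℂ) * Complex.exp (Complex.I * l) ^ k‖ := by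
      simpa [norm_exp_I_mul] using ha
    have h2 : HasSum (fun k : ℕ => (starRingEnd ℂ) ((a k : ℂ) * Complex.exp (Complex.I * l) ^ k))
        ((starRingEnd ℂ) (A l)) := Complex.hasSum_conj'.2 (hA l)
    have hn' : Summable fun k : ℕ =>
        ‖(starRingEnd ℂ) ((a k : ℂ) * Complex.exp (Complex.I * l) ^ k)‖ := by
      simpa only [RCLike.norm_conj] using hn
    have h3 := hasSum_mul_of_summable_norm (hA l) h2 hn hn'
    have h4 := h3.mul_left (Complex.exp (Complex.I * h * l))
    rw [Complex.mul_conj, Complex.normSq_eq_norm_sq] at h4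
    refine h4.congr_fun fun p => ?_
    simp only [hF, map_mul, map_pow, Complex.conj_ofReal, ← Complex.exp_conj, Complex.conj_I]
    rw [← Complex.exp_nat_mul, ← Complex.exp_nat_mul,
      show Complex.I * ((h + p.1 - p.2 : ℤ) : ℂ) * l = Complex.I * h * l +
        (p.1 * (Complex.I * l) + p.2 * (-Complex.I * l)) by push_cast; ring,
      Complex.exp_add, Complex.exp_add]
    push_cast; ring
  have hint : HasSum (fun p => ∫ l in (-Real.pi)..Real.pi, F p l)
      (∫ l in (-Real.pi)..Real.pi,
        Complex.exp (Complex.I * h * l) * ((‖A l‖ ^ 2 : ℝ) : ℂ)) := by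
    refine intervalIntegral.hasSum_integral_of_dominated_convergence
      (fun p _ => |a p.1 * a p.2|) (fun p => ?_) (fun p => ?_) ?_ ?_ ?_
    · exact (by fun_prop : Continuous (F p)).aestronglyMeasurable
    · refine ae_of_all _ fun l _ => ?_
      have : ‖Complex.exp (Complex.I * ((h + p.1 - p.2 : ℤ) : ℂ) * l)‖ = 1 := by
        have := norm_exp_I_mul (((h + p.1 - p.2 : ℤ) : ℝ) * l)
        rw [← this]; congr 2; push_cast; ring
      rw [norm_mul, this, mul_one, Complex.norm_real, Real.norm_eq_abs]
    · exact ae_of_all _ fun l _ => hprod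
    · simp
    · exact ae_of_all _ fun l _ => hpt l
  have hval : ∀ p, ∫ l in (-Real.pi)..Real.pi, F p l =
      if (h + p.1 - p.2 : ℤ) = 0 then 2 * Real.pi * ((a p.1 * a p.2 : ℝ) : ℂ) else 0 := by
    intro p
    simp only [hF]
    rw [intervalIntegral.integral_const_mul, integral_exp_int_mul]
    split_ifs <;> ring
  simp_rw [hval] at hint
  -- Only the index pairs `(j, j + h)` have zero frequency, so the double sum collapses to a single
  -- one.
  have hinj : Function.Injective fun j : ℕ => (j, j + h) := fun x y hxy => (Prod.ext_iff.1 hxy).1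
  rw [← hinj.hasSum_iff] at hint
  · rw [← hint.tsum_eq, Complex.ofReal_tsum, ← tsum_mul_left]
    refine tsum_congr fun j => ?_
    simp only [Function.comp_apply]
    rw [if_pos (by push_cast; ring)]
  · rintro ⟨j, k⟩ hjk
    rw [if_neg]
    intro h0
    apply hjk
    refine ⟨j, ?_⟩
    simp only [Prod.mk.injEq, true_and]
    simp only at h0
    omega

theorem integral_exp_mul_even {g : ℝ → ℝ} (hg : ∀ l, g (-l) = g l) (h : ℤ) :
    ∫ l in (-Real.pi)..Real.pi, Complex.exp (Complex.I * h * l) * (g l : ℂ) =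
      ∫ l in (-Real.pi)..Real.pi, Complex.exp (Complex.I * h.natAbs * l) * (g l : ℂ) := by
  obtain ⟨n, rfl | rfl⟩ := h.eq_nat_or_neg
  · simp
  · rw [Int.natAbs_neg, Int.natAbs_natCast]
    have := intervalIntegral.integral_comp_neg (a := -Real.pi) (b := Real.pi)
      (fun l : ℝ => Complex.exp (Complex.I * n * l) * (g l : ℂ))
    rw [neg_neg] at this
    rw [← this]
    congr 1
    ext l
    rw [hg]
    push_cast
    ring_nf

/-! ### The spectral density: lower bound, continuity, integrability, Fourier coefficients. -/

section SpectralDensity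

variable {φ : ℝ → ℝ} {v : ℝ}

theorem norm_one_sub_mul_exp_sq (x l : ℝ) :
    ‖1 - (x : ℂ) * Complex.exp (Complex.I * l)‖ ^ 2 = 1 - 2 * x * Real.cos l + x ^ 2 := by
  rw [← Complex.normSq_eq_norm_sq, Complex.normSq_apply, mul_comm Complex.I,
    Complex.exp_mul_I, ← Complex.ofReal_cos, ← Complex.ofReal_sin]
  simp only [Complex.sub_re, Complex.one_re, Complex.mul_re, Complex.ofReal_re, Complex.add_re,
    Complex.I_re, mul_zero, Complex.ofReal_im, Complex.I_im, mul_one, sub_self, add_zero,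
    Complex.add_im, Complex.mul_im, zero_add, zero_mul, sub_zero, Complex.sub_im, Complex.one_im,
    zero_sub]
  nlinarith [Real.sin_sq_add_cos_sq l]

theorem spectralDensity_eq (φ : ℝ → ℝ) (v l : ℝ) : spectralDensity φ v l =
    v / (2 * Real.pi) * ∫ x in (-1 : ℝ)..1, φ x / (1 - 2 * x * Real.cos l + x ^ 2) := by
  simp_rw [spectralDensity, norm_one_sub_mul_exp_sq]

theorem spectralDensity_neg (φ : ℝ → ℝ) (v l : ℝ) :
    spectralDensity φ v (-l) = spectralDensity φ v l := by
  simp_rw [spectralDensity_eq, Real.cos_neg]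

/-- Completing the square gives `sin² l + (x - cos l)²`. Where `sin l ≠ 0`, the denominator is thus
bounded below uniformly in `x`. -/
theorem sin_sq_le_quadratic (x l : ℝ) : Real.sin l ^ 2 ≤ 1 - 2 * x * Real.cos l + x ^ 2 := by
  nlinarith [Real.sin_sq_add_cos_sq l, sq_nonneg (x - Real.cos l)]

theorem quadratic_nonneg (x l : ℝ) : 0 ≤ 1 - 2 * x * Real.cos l + x ^ 2 :=
  (sq_nonneg _).trans (sin_sq_le_quadratic x l)

theorem quadratic_le_four {x : ℝ} (hx : x ∈ Set.Icc (-1 : ℝ) 1) (l : ℝ) :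
    1 - 2 * x * Real.cos l + x ^ 2 ≤ 4 := by
  rw [← norm_one_sub_mul_exp_sq]
  have h : ‖1 - (x : ℂ) * Complex.exp (Complex.I * l)‖ ≤ 2 := by
    refine (norm_sub_le _ _).trans ?_
    rw [norm_one, norm_mul, norm_exp_I_mul, mul_one, Complex.norm_real, Real.norm_eq_abs]
    linarith [abs_le.2 hx]
  nlinarith [norm_nonneg (1 - (x : ℂ) * Complex.exp (Complex.I * l))]

theorem IsMixtureDensity.intervalIntegrable (hφ : IsMixtureDensity φ) :
    IntervalIntegrable φ volume (-1) 1 := by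
  rw [intervalIntegrable_iff_integrableOn_Icc_of_le (by norm_num)]
  exact hφ.integrable

theorem IsMixtureDensity.intervalIntegrable_div (hφ : IsMixtureDensity φ) {l : ℝ}
    (hl : Real.sin l ≠ 0) :
    IntervalIntegrable (fun x => φ x / (1 - 2 * x * Real.cos l + x ^ 2)) volume (-1) 1 := by
  have := hφ.measurable
  refine (hφ.intervalIntegrable.div_const (Real.sin l ^ 2)).mono_fun
    (by exact Measurable.aestronglyMeasurable (by fun_prop)) (ae_of_all _ fun x => ?_)
  have hs : 0 < Real.sin l ^ 2 := by positivity
  beta_reduce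
  rw [Real.norm_of_nonneg (div_nonneg (hφ.nonneg x) (quadratic_nonneg x l)),
    Real.norm_of_nonneg (div_nonneg (hφ.nonneg x) hs.le)]
  exact div_le_div_of_nonneg_left (hφ.nonneg x) hs (sin_sq_le_quadratic x l)

/-- The denominator is at most 4 and `φ` has mass 1, so the integral is at least `1 / 4`. The
condition on `l` secures integrability; without it the integral might take its default value 0. -/
theorem le_spectralDensity (hφ : IsMixtureDensity φ) (hv : 0 < v) {l : ℝ} (hl : Real.sin l ≠ 0) :
    v / (8 * Real.pi) ≤ spectralDensity φ v l := by
  rw [spectralDensity_eq]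
  have h : (1 / 4 : ℝ) ≤ ∫ x in (-1 : ℝ)..1, φ x / (1 - 2 * x * Real.cos l + x ^ 2) := by
    rw [show (1 / 4 : ℝ) = ∫ x in (-1 : ℝ)..1, φ x / 4 by
      rw [intervalIntegral.integral_div, hφ.integral_eq_one]]
    refine intervalIntegral.integral_mono_on (by norm_num) (hφ.intervalIntegrable.div_const 4)
      (hφ.intervalIntegrable_div hl) fun x hx => ?_
    have hs : 0 < Real.sin l ^ 2 := by positivity
    exact div_le_div_of_nonneg_left (hφ.nonneg x) (hs.trans_le (sin_sq_le_quadratic x l))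
      (quadratic_le_four hx l)
  have hp := Real.pi_pos
  calc v / (8 * Real.pi) = v / (2 * Real.pi) * (1 / 4) := by field_simp; norm_num
    _ ≤ _ := by gcongr

theorem spectralDensity_nonneg (hφ : IsMixtureDensity φ) (hv : 0 < v) (l : ℝ) :
    0 ≤ spectralDensity φ v l := by
  rw [spectralDensity_eq]
  have hp := Real.pi_pos
  refine mul_nonneg (by positivity) (intervalIntegral.integral_nonneg (by norm_num) fun x _ => ?_)
  exact div_nonneg (hφ.nonneg x) (quadratic_nonneg x l)

/-- Near `l` one has `sin² y > sin² l / 2`, so `φ / (sin² l / 2)` dominates. -/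
theorem continuousAt_spectralDensity (hφ : IsMixtureDensity φ) {l : ℝ} (hl : Real.sin l ≠ 0) :
    ContinuousAt (spectralDensity φ v) l := by
  have hm := hφ.measurable
  rw [funext (spectralDensity_eq φ v)]
  refine continuousAt_const.mul ?_
  have hs : 0 < Real.sin l ^ 2 := by positivity
  have hev : ∀ᶠ y in 𝓝 l, Real.sin l ^ 2 / 2 < Real.sin y ^ 2 :=
    (by fun_prop : Continuous fun y => Real.sin y ^ 2).continuousAt.eventually_const_lt
      (by linarith)
  refine intervalIntegral.continuousAt_of_dominated_interval
    (bound := fun x => φ x / (Real.sin l ^ 2 / 2)) ?_ ?_ (hφ.intervalIntegrable.div_const _) ?_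
  · exact Eventually.of_forall fun y => Measurable.aestronglyMeasurable (by fun_prop)
  · filter_upwards [hev] with y hy
    refine ae_of_all _ fun x _ => ?_
    rw [Real.norm_of_nonneg (div_nonneg (hφ.nonneg x) (quadratic_nonneg x y))]
    exact div_le_div_of_nonneg_left (hφ.nonneg x) (by positivity)
      (hy.le.trans (sin_sq_le_quadratic x y))
  · refine ae_of_all _ fun x _ => ContinuousAt.div continuousAt_const (by fun_prop) ?_
    exact (hs.trans_le (sin_sq_le_quadratic x l)).ne'

theorem ae_sin_ne_zero : ∀ᵐ l ∂(volume.restrict (Set.Ioc (-Real.pi) Real.pi)), Real.sin l ≠ 0 := by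
  have h : ∀ c : ℝ, ∀ᵐ l : ℝ, l ≠ c := fun c => by simp [ae_iff, measure_singleton]
  rw [ae_restrict_iff' measurableSet_Ioc]
  filter_upwards [h 0, h Real.pi] with l h0 h1 hl hs
  rcases lt_or_gt_of_ne h0 with h2 | h2
  · exact (Real.sin_neg_of_neg_of_neg_pi_lt h2 hl.1).ne hs
  · exact (Real.sin_pos_of_pos_of_lt_pi h2 (lt_of_le_of_ne hl.2 h1)).ne' hs

/-- The reciprocal is the squared modulus of the geometric series `∑ x ^ k e^{ikl}`. -/
theorem integral_exp_mul_inv_quadratic {x : ℝ} (hx : |x| < 1) (h : ℕ) :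
    ∫ l in (-Real.pi)..Real.pi, Complex.exp (Complex.I * h * l) *
      (((1 - 2 * x * Real.cos l + x ^ 2)⁻¹ : ℝ) : ℂ) =
      2 * Real.pi * ((x ^ h / (1 - x ^ 2) : ℝ) : ℂ) := by
  have h3 : |x ^ 2| < 1 := by rw [abs_pow]; exact pow_lt_one₀ (abs_nonneg _) hx two_ne_zero
  have := integral_exp_mul_norm_sq_of_hasSum (a := fun k => x ^ k)
    (A := fun l => (1 - (x : ℂ) * Complex.exp (Complex.I * l))⁻¹)
    (by simpa [abs_pow] using summable_geometric_of_lt_one (abs_nonneg x) hx) (fun l => by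
      have := hasSum_geometric_of_norm_lt_one (ξ := (x : ℂ) * Complex.exp (Complex.I * l))
        (by rwa [norm_mul, norm_exp_I_mul, mul_one, Complex.norm_real])
      simpa [mul_pow] using this) h
  simp_rw [norm_inv, inv_pow, norm_one_sub_mul_exp_sq] at this
  rw [this]
  congr 2
  rw [div_eq_mul_inv, ← tsum_geometric_of_abs_lt_one h3, ← tsum_mul_left]
  refine tsum_congr fun k => ?_
  ring

/-- By Tonelli: integrating in the frequency first leaves `2π φ(x) / (1 - x²)`, so the integrability
condition on the mixture density is exactly what is needed. -/
theorem integrable_prod_spectral (hφ : IsMixtureDensity φ) :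
    Integrable (fun p : ℝ × ℝ => φ p.1 * (1 - 2 * p.1 * Real.cos p.2 + p.1 ^ 2)⁻¹)
      ((volume.restrict (Set.Ioc (-1 : ℝ) 1)).prod
        (volume.restrict (Set.Ioc (-Real.pi) Real.pi))) := by
  have hm := hφ.measurable
  have hlt : ∀ᵐ x ∂(volume.restrict (Set.Ioc (-1 : ℝ) 1)), |x| < 1 := by
    have h1 : ∀ᵐ x : ℝ, x ≠ 1 := by simp [ae_iff, measure_singleton]
    rw [ae_restrict_iff' measurableSet_Ioc]
    filter_upwards [h1] with x hx hx2
    exact abs_lt.2 ⟨hx2.1, lt_of_le_of_ne hx2.2 hx⟩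
  rw [integrable_prod_iff (Measurable.aestronglyMeasurable (by fun_prop))]
  constructor
  · filter_upwards [hlt] with x hx
    have : Continuous fun l => φ x * (1 - 2 * x * Real.cos l + x ^ 2)⁻¹ := by
      refine continuous_const.mul (Continuous.inv₀ (by fun_prop) fun l => ?_)
      rw [← norm_one_sub_mul_exp_sq]
      have : (1 - (x : ℂ) * Complex.exp (Complex.I * l)) ≠ 0 := by
        intro h0
        have := congrArg norm (sub_eq_zero.1 h0)
        rw [norm_one, norm_mul, norm_exp_I_mul, mul_one, Complex.norm_real] at this
        exact hx.ne this.symm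
      positivity
    exact (this.integrableOn_Icc).mono_set Set.Ioc_subset_Icc_self
  · have hd := (hφ.integrable_div.mono_set (Set.Ioc_subset_Icc_self)).const_mul (2 * Real.pi)
    refine Integrable.congr hd ?_
    filter_upwards [hlt] with x hx
    have h0 := integral_exp_mul_inv_quadratic hx 0
    simp only [Nat.cast_zero, mul_zero, zero_mul, Complex.exp_zero, one_mul, pow_zero,
      intervalIntegral.integral_ofReal] at h0
    have h1 : ∫ l in (-Real.pi)..Real.pi, (1 - 2 * x * Real.cos l + x ^ 2)⁻¹ =
      2 * Real.pi * (1 / (1 - x ^ 2)) := by exact_mod_cast h0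
    have h2 : ∀ l, ‖φ x * (1 - 2 * x * Real.cos l + x ^ 2)⁻¹‖ =
        φ x * (1 - 2 * x * Real.cos l + x ^ 2)⁻¹ := fun l =>
      Real.norm_of_nonneg (mul_nonneg (hφ.nonneg x) (inv_nonneg.2 (quadratic_nonneg x l)))
    simp_rw [h2]
    rw [← intervalIntegral.integral_of_le (by linarith [Real.pi_pos]),
      intervalIntegral.integral_const_mul, h1]
    ring

theorem intervalIntegrable_spectralDensity (hφ : IsMixtureDensity φ) :
    IntervalIntegrable (spectralDensity φ v) volume (-Real.pi) Real.pi := by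
  rw [intervalIntegrable_iff_integrableOn_Ioc_of_le (by linarith [Real.pi_pos])]
  have := ((integrable_prod_spectral hφ).integral_prod_right).const_mul (v / (2 * Real.pi))
  refine this.congr (ae_of_all _ fun l => ?_)
  simp only [spectralDensity_eq]
  rw [intervalIntegral.integral_of_le (by norm_num)]
  rfl

theorem integral_exp_mul_spectralDensity (hφ : IsMixtureDensity φ) (h : ℤ) :
    ∫ l in (-Real.pi)..Real.pi, Complex.exp (Complex.I * h * l) * (spectralDensity φ v l : ℂ) =
      (autocov φ v h : ℂ) := by
  rw [integral_exp_mul_even (spectralDensity_neg φ v)]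
  generalize hn : h.natAbs = n
  have hp := Real.pi_pos
  have hprod : Integrable (fun p : ℝ × ℝ => Complex.exp (Complex.I * n * p.2) *
      ((φ p.1 * (1 - 2 * p.1 * Real.cos p.2 + p.1 ^ 2)⁻¹ : ℝ) : ℂ))
      ((volume.restrict (Set.Ioc (-1 : ℝ) 1)).prod
        (volume.restrict (Set.Ioc (-Real.pi) Real.pi))) := by
    refine ((integrable_prod_spectral hφ).ofReal (𝕜 := ℂ)).bdd_mul (c := 1)
      (by exact (by fun_prop : Continuous _).aestronglyMeasurable) (ae_of_all _ fun p => ?_)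
    have := norm_exp_I_mul (n * p.2)
    rw [← this.le.antisymm this.ge]
    push_cast
    rw [mul_assoc]
  have hswap := integral_integral_swap (f := fun (x l : ℝ) => Complex.exp (Complex.I * n * l) *
      ((φ x * (1 - 2 * x * Real.cos l + x ^ 2)⁻¹ : ℝ) : ℂ)) hprod
  have hlt : ∀ᵐ x ∂(volume.restrict (Set.Ioc (-1 : ℝ) 1)), |x| < 1 := by
    have h1 : ∀ᵐ x : ℝ, x ≠ 1 := by simp [ae_iff, measure_singleton]
    rw [ae_restrict_iff' measurableSet_Ioc]
    filter_upwards [h1] with x hx hx2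
    exact abs_lt.2 ⟨hx2.1, lt_of_le_of_ne hx2.2 hx⟩
  have hL : ∀ l : ℝ, Complex.exp (Complex.I * n * l) * (spectralDensity φ v l : ℂ) =
      (v / (2 * Real.pi) : ℂ) * ∫ x in Set.Ioc (-1 : ℝ) 1, Complex.exp (Complex.I * n * l) *
      ((φ x * (1 - 2 * x * Real.cos l + x ^ 2)⁻¹ : ℝ) : ℂ) := by
    intro l
    rw [integral_const_mul, integral_complex_ofReal, spectralDensity_eq,
      intervalIntegral.integral_of_le (by norm_num)]
    simp only [div_eq_mul_inv]
    push_cast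
    ring
  simp_rw [hL]
  rw [intervalIntegral.integral_const_mul, intervalIntegral.integral_of_le (by linarith), ← hswap]
  have hR : ∀ᵐ x ∂(volume.restrict (Set.Ioc (-1 : ℝ) 1)),
      ∫ l in Set.Ioc (-Real.pi) Real.pi, Complex.exp (Complex.I * n * l) *
      ((φ x * (1 - 2 * x * Real.cos l + x ^ 2)⁻¹ : ℝ) : ℂ) =
      ((2 * Real.pi * (φ x * (x ^ n / (1 - x ^ 2))) : ℝ) : ℂ) := by
    filter_upwards [hlt] with x hx
    have := integral_exp_mul_inv_quadratic hx n
    rw [intervalIntegral.integral_of_le (by linarith)] at this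
    simp_rw [Complex.ofReal_mul (φ x), mul_left_comm _ (φ x : ℂ)]
    rw [integral_const_mul, this]
    push_cast; ring
  rw [integral_congr_ae hR, integral_complex_ofReal, integral_const_mul, autocov, hn,
    intervalIntegral.integral_of_le (by norm_num)]
  push_cast
  have : (Real.pi : ℂ) ≠ 0 := by exact_mod_cast hp.ne'
  field_simp

end SpectralDensity

/-! ### Poisson integrals on the circle. -/

/-- The Poisson kernel `(1 - r²) / |e^{iθ} - r e^{il}|²`. -/
noncomputable def poisson (r l θ : ℝ) : ℝ :=
  (1 - r ^ 2) * (1 - 2 * r * Real.cos (θ - l) + r ^ 2)⁻¹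

/-- The Poisson integral of `g`. -/
noncomputable def poissonIntegral (g : ℝ → ℝ) (r l : ℝ) : ℝ :=
  (2 * Real.pi)⁻¹ * ∫ θ in (-Real.pi)..Real.pi, poisson r l θ * g θ

theorem one_sub_sq_le_quadratic {r : ℝ} (hr : 0 ≤ r) (x : ℝ) :
    (1 - r) ^ 2 ≤ 1 - 2 * r * Real.cos x + r ^ 2 := by
  nlinarith [Real.cos_le_one x]

theorem quadratic_pos {r : ℝ} (hr : 0 ≤ r) (hr1 : r < 1) (x : ℝ) :
    0 < 1 - 2 * r * Real.cos x + r ^ 2 :=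
  lt_of_lt_of_le (by have : 0 < 1 - r := by linarith
                     positivity) (one_sub_sq_le_quadratic hr x)

theorem poisson_nonneg {r : ℝ} (hr : 0 ≤ r) (hr1 : r < 1) (l θ : ℝ) : 0 ≤ poisson r l θ :=
  mul_nonneg (by nlinarith) (inv_nonneg.2 (quadratic_pos hr hr1 _).le)

theorem poisson_le {r : ℝ} (hr : 0 ≤ r) (hr1 : r < 1) (l θ : ℝ) :
    poisson r l θ ≤ (1 - r ^ 2) * ((1 - r) ^ 2)⁻¹ := by
  have : 0 < 1 - r := by linarith
  exact mul_le_mul_of_nonneg_left (inv_anti₀ (by positivity) (one_sub_sq_le_quadratic hr _))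
    (by nlinarith)

theorem poisson_comm (r l θ : ℝ) : poisson r l θ = poisson r θ l := by
  rw [poisson, poisson, ← Real.cos_neg, neg_sub]

theorem continuous_poisson {r : ℝ} (hr : 0 ≤ r) (hr1 : r < 1) :
    Continuous fun p : ℝ × ℝ => poisson r p.1 p.2 :=
  continuous_const.mul (Continuous.inv₀ (by fun_prop) fun p => (quadratic_pos hr hr1 _).ne')

theorem continuous_poisson_right {r : ℝ} (hr : 0 ≤ r) (hr1 : r < 1) (l : ℝ) :
    Continuous (poisson r l) :=
  continuous_const.mul (Continuous.inv₀ (by fun_prop) fun _ => (quadratic_pos hr hr1 _).ne')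

theorem integral_poisson {r : ℝ} (hr : 0 ≤ r) (hr1 : r < 1) (l : ℝ) :
    ∫ θ in (-Real.pi)..Real.pi, poisson r l θ = 2 * Real.pi := by
  have h0 := integral_exp_mul_inv_quadratic (x := r) (by rwa [abs_of_nonneg hr]) 0
  simp only [Nat.cast_zero, mul_zero, zero_mul, Complex.exp_zero, one_mul, pow_zero,
    intervalIntegral.integral_ofReal] at h0
  have h1 : ∫ l in (-Real.pi)..Real.pi, (1 - 2 * r * Real.cos l + r ^ 2)⁻¹ =
    2 * Real.pi * (1 / (1 - r ^ 2)) := by exact_mod_cast h0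
  have hper : Function.Periodic (fun l => (1 - 2 * r * Real.cos l + r ^ 2)⁻¹) (2 * Real.pi) := by
    intro x; simp only [Real.cos_add_two_pi]
  have h2 := hper.intervalIntegral_add_eq (-Real.pi - l) (-Real.pi)
  rw [show -Real.pi - l + 2 * Real.pi = Real.pi - l by ring,
    show -Real.pi + 2 * Real.pi = Real.pi by ring, h1] at h2
  simp only [poisson]
  rw [intervalIntegral.integral_const_mul,
    intervalIntegral.integral_comp_sub_right (fun x => (1 - 2 * r * Real.cos x + r ^ 2)⁻¹), h2]
  have : 1 - r ^ 2 ≠ 0 := by nlinarith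
  field_simp

theorem intervalIntegrable_poisson_mul {r : ℝ} (hr : 0 ≤ r) (hr1 : r < 1) {g : ℝ → ℝ}
    (hg : IntervalIntegrable g volume (-Real.pi) Real.pi) (l : ℝ) :
    IntervalIntegrable (fun θ => poisson r l θ * g θ) volume (-Real.pi) Real.pi :=
  hg.continuousOn_mul (continuous_poisson_right hr hr1 l).continuousOn

theorem integrable_prod_poisson {r : ℝ} (hr : 0 ≤ r) (hr1 : r < 1) {g : ℝ → ℝ}
    (hg : IntervalIntegrable g volume (-Real.pi) Real.pi) :
    Integrable (fun p : ℝ × ℝ => poisson r p.1 p.2 * g p.2)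
      ((volume.restrict (Set.Ioc (-Real.pi) Real.pi)).prod
        (volume.restrict (Set.Ioc (-Real.pi) Real.pi))) := by
  rw [intervalIntegrable_iff_integrableOn_Ioc_of_le (by linarith [Real.pi_pos])] at hg
  refine (hg.integrable.comp_snd _).bdd_mul (c := (1 - r ^ 2) * ((1 - r) ^ 2)⁻¹)
    (continuous_poisson hr hr1).aestronglyMeasurable (ae_of_all _ fun p => ?_)
  rw [Real.norm_of_nonneg (poisson_nonneg hr hr1 _ _)]
  exact poisson_le hr hr1 _ _

theorem intervalIntegrable_poissonIntegral {r : ℝ} (hr : 0 ≤ r) (hr1 : r < 1) {g : ℝ → ℝ}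
    (hg : IntervalIntegrable g volume (-Real.pi) Real.pi) :
    IntervalIntegrable (poissonIntegral g r) volume (-Real.pi) Real.pi := by
  rw [intervalIntegrable_iff_integrableOn_Ioc_of_le (by linarith [Real.pi_pos])]
  refine (((integrable_prod_poisson hr hr1 hg).integral_prod_left).const_mul
    (2 * Real.pi)⁻¹).congr (ae_of_all _ fun l => ?_)
  simp only [poissonIntegral]
  rw [intervalIntegral.integral_of_le (by linarith [Real.pi_pos])]

/-- Fubini, with the symmetry of the kernel in its two angles. -/
theorem integral_poissonIntegral {r : ℝ} (hr : 0 ≤ r) (hr1 : r < 1) {g : ℝ → ℝ}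
    (hg : IntervalIntegrable g volume (-Real.pi) Real.pi) :
    ∫ l in (-Real.pi)..Real.pi, poissonIntegral g r l = ∫ l in (-Real.pi)..Real.pi, g l := by
  have hp := Real.pi_pos
  have hswap := integral_integral_swap (f := fun (l θ : ℝ) => poisson r l θ * g θ)
    (integrable_prod_poisson hr hr1 hg)
  simp_rw [← intervalIntegral.integral_of_le (show -Real.pi ≤ Real.pi by linarith)] at hswap
  simp only [poissonIntegral]
  rw [intervalIntegral.integral_const_mul, hswap]
  simp_rw [intervalIntegral.integral_mul_const, poisson_comm r _ _, integral_poisson hr hr1]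
  rw [intervalIntegral.integral_const_mul]
  field_simp

/-- The kernels form an approximate identity: they are nonnegative, have total mass 1 after
normalization, and concentrate at `l`. -/
theorem tendsto_poissonIntegral {g : ℝ → ℝ}
    (hg : IntervalIntegrable g volume (-Real.pi) Real.pi) {l : ℝ}
    (hl : l ∈ Set.Ioo (-Real.pi) Real.pi) (hc : ContinuousAt g l) :
    Tendsto (fun r => poissonIntegral g r l) (𝓝[<] 1) (𝓝 (g l)) := by
  have hp := Real.pi_pos
  -- The denominator equals `(1 - r)² + 2r(1 - cos(θ - l))`; for `r > 1/2` it is at least `1 - cos(θ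
  -- - l)`, a bound independent of `r`.
  have hr : ∀ᶠ r : ℝ in 𝓝[<] 1, 1 / 2 < r ∧ r < 1 :=
    (eventually_nhdsWithin_of_eventually_nhds (eventually_gt_nhds (by norm_num))).and
      (eventually_mem_nhdsWithin)
  have h := tendsto_setIntegral_peak_smul_of_integrableOn_of_tendsto (μ := volume) (l := 𝓝[<] 1)
    (φ := fun r θ => (2 * Real.pi)⁻¹ * poisson r l θ) (g := g) (x₀ := l) (a := g l)
    (s := Set.Ioc (-Real.pi) Real.pi) measurableSet_Ioc (t := Set.Ioc (-Real.pi) Real.pi)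
    measurableSet_Ioc subset_rfl self_mem_nhdsWithin (by simp) ?_ ?_ ?_ ?_ ?_
    (hc.tendsto.mono_left nhdsWithin_le_nhds)
  · refine h.congr fun r => ?_
    rw [poissonIntegral, intervalIntegral.integral_of_le (by linarith), ← integral_const_mul]
    simp only [smul_eq_mul, mul_assoc]
  · filter_upwards [hr] with r hr θ _
    exact mul_nonneg (by positivity) (poisson_nonneg (by linarith) hr.2 _ _)
  · intro U hU hlU
    have hK : IsCompact (Set.Icc (-Real.pi) Real.pi \ U) := isCompact_Icc.diff hU
    -- Since `l` is interior, `θ - l` stays in `(-2π, 2π)`, even at the endpoints, so its cosine is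
    -- 1 only at `θ = l`.
    have hpos : ∀ θ ∈ Set.Icc (-Real.pi) Real.pi \ U, 0 < 1 - Real.cos (θ - l) := by
      rintro θ ⟨hθ, hθU⟩
      refine sub_pos.2 (lt_of_le_of_ne (Real.cos_le_one _) fun h1 => hθU ?_)
      rw [Real.cos_eq_one_iff_of_lt_of_lt (by linarith [hθ.1, hl.2]) (by linarith [hθ.2, hl.1])]
        at h1
      rwa [sub_eq_zero.1 h1]
    obtain ⟨m, hm, hmK⟩ : ∃ m : ℝ, 0 < m ∧
        ∀ θ ∈ Set.Icc (-Real.pi) Real.pi \ U, m ≤ 1 - Real.cos (θ - l) := by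
      rcases (Set.Icc (-Real.pi) Real.pi \ U).eq_empty_or_nonempty with he | hne
      · exact ⟨1, one_pos, by simp [he]⟩
      · obtain ⟨θ, hθ, hmin⟩ := hK.exists_isMinOn hne
          (f := fun θ => 1 - Real.cos (θ - l)) (by fun_prop)
        exact ⟨_, hpos θ hθ, fun x hx => hmin hx⟩
    have hlim : Tendsto (fun r : ℝ => (2 * Real.pi)⁻¹ * ((1 - r ^ 2) * m⁻¹)) (𝓝[<] 1) (𝓝 0) := by
      have : ContinuousAt (fun r : ℝ => (2 * Real.pi)⁻¹ * ((1 - r ^ 2) * m⁻¹)) 1 := by fun_prop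
      simpa using this.tendsto.mono_left (nhdsWithin_le_nhds (s := Set.Iio 1))
    rw [Metric.tendstoUniformlyOn_iff]
    intro δ hδ
    filter_upwards [hr, hlim.eventually_lt_const hδ] with r hr hrδ θ hθ
    have hr0 : 0 ≤ r := by linarith
    have h1 := hmK θ ⟨Set.Ioc_subset_Icc_self hθ.1, hθ.2⟩
    rw [Pi.zero_apply, dist_zero_left, Real.norm_of_nonneg
      (mul_nonneg (by positivity) (poisson_nonneg hr0 hr.2 _ _))]
    refine lt_of_le_of_lt ?_ hrδ
    refine mul_le_mul_of_nonneg_left (mul_le_mul_of_nonneg_left (inv_anti₀ hm ?_) (by nlinarith))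
      (by positivity)
    nlinarith [sq_nonneg (1 - r)]
  · refine tendsto_const_nhds.congr' ?_
    filter_upwards [hr] with r hr
    rw [integral_const_mul, ← intervalIntegral.integral_of_le (by linarith),
      integral_poisson (by linarith) hr.2, inv_mul_cancel₀ (by positivity)]
  · filter_upwards [hr] with r hr
    exact (continuous_const.mul
      (continuous_poisson_right (by linarith) hr.2 l)).aestronglyMeasurable
  · rwa [← intervalIntegrable_iff_integrableOn_Ioc_of_le (by linarith)]

/-! ### Integrability of `log f` and boundary behaviour of `exp(P_r log f)`. -/

section LogIntegrable

variable {f : ℝ → ℝ} {δ : ℝ}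

/-- Almost everywhere `log δ ≤ log f ≤ f - 1`. -/
theorem intervalIntegrable_log_of_le (hint : IntervalIntegrable f volume (-Real.pi) Real.pi)
    (hδ : 0 < δ) (hlow : ∀ l, Real.sin l ≠ 0 → δ ≤ f l) :
    IntervalIntegrable (fun l => Real.log (f l)) volume (-Real.pi) Real.pi := by
  rw [intervalIntegrable_iff_integrableOn_Ioc_of_le (by linarith [Real.pi_pos])] at hint ⊢
  refine Integrable.mono' (hint.norm.add (integrable_const |Real.log δ|))
    (Real.measurable_log.comp_aemeasurable hint.1.aemeasurable).aestronglyMeasurable ?_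
  filter_upwards [ae_sin_ne_zero] with l hl
  have h1 := hlow l hl
  have hf : 0 < f l := hδ.trans_le h1
  simp only [Pi.add_apply]
  rw [Real.norm_eq_abs, Real.norm_eq_abs, abs_of_pos hf, abs_le]
  have h2 := Real.log_le_log hδ h1
  have h3 := Real.log_le_sub_one_of_pos hf
  have h4 := neg_abs_le (Real.log δ)
  have h5 := abs_nonneg (Real.log δ)
  constructor <;> linarith

/-- Jensen's inequality for `exp` and the normalized Poisson kernel. -/
theorem exp_poissonIntegral_log_le (hint : IntervalIntegrable f volume (-Real.pi) Real.pi)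
    (hδ : 0 < δ) (hlow : ∀ l, Real.sin l ≠ 0 → δ ≤ f l) {r : ℝ} (hr : 0 ≤ r) (hr1 : r < 1)
    (l : ℝ) :
    Real.exp (poissonIntegral (fun l => Real.log (f l)) r l) ≤ poissonIntegral f r l := by
  have hp := Real.pi_pos
  set m := poissonIntegral (fun l => Real.log (f l)) r l with hm
  have hlog := intervalIntegrable_log_of_le hint hδ hlow
  have hP := intervalIntegrable_poisson_mul hr hr1 hlog l
  have hP1 : IntervalIntegrable (poisson r l) volume (-Real.pi) Real.pi :=
    (continuous_poisson_right hr hr1 l).intervalIntegrable _ _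
  -- The left integrand is the kernel times the tangent line of `exp` at `m`, evaluated at `log f`.
  have hle : ∫ θ in (-Real.pi)..Real.pi, (Real.exp m * (1 - m) * poisson r l θ +
      Real.exp m * (poisson r l θ * Real.log (f θ))) ≤
      ∫ θ in (-Real.pi)..Real.pi, poisson r l θ * f θ := by
    refine intervalIntegral.integral_mono_ae_restrict (by linarith)
      ((hP1.const_mul _).add (hP.const_mul _)) (intervalIntegrable_poisson_mul hr hr1 hint l) ?_
    rw [Measure.restrict_congr_set Ioc_ae_eq_Icc.symm]
    filter_upwards [ae_sin_ne_zero] with θ hθ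
    have hf : 0 < f θ := hδ.trans_le (hlow θ hθ)
    have h1 := Real.add_one_le_exp (Real.log (f θ) - m)
    have h2 : Real.exp m * (Real.log (f θ) - m + 1) ≤ f θ := by
      calc _ ≤ Real.exp m * Real.exp (Real.log (f θ) - m) := by gcongr
        _ = f θ := by rw [← Real.exp_add, add_sub_cancel, Real.exp_log hf]
    have := mul_le_mul_of_nonneg_left h2 (poisson_nonneg hr hr1 l θ)
    linarith
  rw [intervalIntegral.integral_add (hP1.const_mul _) (hP.const_mul _),
    intervalIntegral.integral_const_mul, intervalIntegral.integral_const_mul,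
    integral_poisson hr hr1] at hle
  have hm' : ∫ θ in (-Real.pi)..Real.pi, poisson r l θ * Real.log (f θ) = 2 * Real.pi * m := by
    rw [hm, poissonIntegral]
    field_simp
  rw [hm'] at hle
  rw [poissonIntegral, le_inv_mul_iff₀ (by positivity)]
  linarith

theorem intervalIntegrable_exp_poissonIntegral
    (hint : IntervalIntegrable f volume (-Real.pi) Real.pi)
    (hδ : 0 < δ) (hlow : ∀ l, Real.sin l ≠ 0 → δ ≤ f l) {r : ℝ} (hr : 0 ≤ r) (hr1 : r < 1) :
    IntervalIntegrable (fun l => Real.exp (poissonIntegral (fun l => Real.log (f l)) r l)) volume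
      (-Real.pi) Real.pi := by
  have h1 := intervalIntegrable_poissonIntegral hr hr1 (intervalIntegrable_log_of_le hint hδ hlow)
  refine (intervalIntegrable_poissonIntegral hr hr1 hint).mono_fun ?_ (ae_of_all _ fun l => ?_)
  · rw [intervalIntegrable_iff] at h1
    exact Real.continuous_exp.comp_aestronglyMeasurable h1.1
  · beta_reduce
    rw [Real.norm_eq_abs, Real.abs_exp]
    exact (exp_poissonIntegral_log_le hint hδ hlow hr hr1 l).trans (le_abs_self _)

/-- This makes `exp(-P_r log f)` bounded by `1 / δ`, uniformly in `r`. -/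
theorem log_le_poissonIntegral_log (hint : IntervalIntegrable f volume (-Real.pi) Real.pi)
    (hδ : 0 < δ) (hlow : ∀ l, Real.sin l ≠ 0 → δ ≤ f l) {r : ℝ} (hr : 0 ≤ r) (hr1 : r < 1)
    (l : ℝ) : Real.log δ ≤ poissonIntegral (fun l => Real.log (f l)) r l := by
  have hp := Real.pi_pos
  have hlog := intervalIntegrable_log_of_le hint hδ hlow
  have hP1 : IntervalIntegrable (poisson r l) volume (-Real.pi) Real.pi :=
    (continuous_poisson_right hr hr1 l).intervalIntegrable _ _
  have hle : ∫ θ in (-Real.pi)..Real.pi, poisson r l θ * Real.log δ ≤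
      ∫ θ in (-Real.pi)..Real.pi, poisson r l θ * Real.log (f θ) := by
    refine intervalIntegral.integral_mono_ae_restrict (by linarith) (hP1.mul_const _)
      (intervalIntegrable_poisson_mul hr hr1 hlog l) ?_
    rw [Measure.restrict_congr_set Ioc_ae_eq_Icc.symm]
    filter_upwards [ae_sin_ne_zero] with θ hθ
    exact mul_le_mul_of_nonneg_left (Real.log_le_log hδ (hlow θ hθ)) (poisson_nonneg hr hr1 l θ)
  rw [intervalIntegral.integral_mul_const, integral_poisson hr hr1] at hle
  rw [poissonIntegral, le_inv_mul_iff₀ (by positivity)]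
  exact hle

theorem ae_tendsto_poissonIntegral_log (hint : IntervalIntegrable f volume (-Real.pi) Real.pi)
    (hδ : 0 < δ) (hlow : ∀ l, Real.sin l ≠ 0 → δ ≤ f l)
    (hcont : ∀ l, Real.sin l ≠ 0 → ContinuousAt f l) :
    ∀ᵐ l ∂(volume.restrict (Set.Ioc (-Real.pi) Real.pi)),
      Tendsto (fun r => poissonIntegral (fun l => Real.log (f l)) r l) (𝓝[<] 1)
        (𝓝 (Real.log (f l))) := by
  have hne : ∀ᵐ l ∂(volume.restrict (Set.Ioc (-Real.pi) Real.pi)), l ∈ Set.Ioc (-Real.pi) Real.pi :=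
    ae_restrict_mem measurableSet_Ioc
  filter_upwards [ae_sin_ne_zero, hne] with l hl hl2
  refine tendsto_poissonIntegral (intervalIntegrable_log_of_le hint hδ hlow)
    ⟨hl2.1, lt_of_le_of_ne hl2.2 ?_⟩ ?_
  · rintro rfl
    exact hl Real.sin_pi
  · exact (hcont l hl).log (hδ.trans_le (hlow l hl)).ne'

theorem eventually_mem_Ico_nhdsLT_one : ∀ᶠ r : ℝ in 𝓝[<] 1, 0 ≤ r ∧ r < 1 :=
  (eventually_nhdsWithin_of_eventually_nhds
    ((eventually_gt_nhds (show (0 : ℝ) < 1 by norm_num)).mono fun _ h => h.le)).and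
      eventually_mem_nhdsWithin

theorem tendsto_integral_mul_exp_neg_poissonIntegral
    (hint : IntervalIntegrable f volume (-Real.pi) Real.pi)
    (hδ : 0 < δ) (hlow : ∀ l, Real.sin l ≠ 0 → δ ≤ f l)
    (hcont : ∀ l, Real.sin l ≠ 0 → ContinuousAt f l) :
    Tendsto (fun r => ∫ l in (-Real.pi)..Real.pi,
      f l * Real.exp (-poissonIntegral (fun l => Real.log (f l)) r l)) (𝓝[<] 1)
      (𝓝 (2 * Real.pi)) := by
  have hp := Real.pi_pos
  have hlog := intervalIntegrable_log_of_le hint hδ hlow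
  have h1 : ∫ l in (-Real.pi)..Real.pi, (1 : ℝ) = 2 * Real.pi := by simp; ring
  rw [← h1]
  have hle : -Real.pi ≤ Real.pi := by linarith
  refine intervalIntegral.tendsto_integral_filter_of_dominated_convergence
    (fun l => |f l| * Real.exp (-Real.log δ)) ?_ ?_ (hint.abs.mul_const _) ?_
  · filter_upwards [eventually_mem_Ico_nhdsLT_one] with r hr
    have := intervalIntegrable_poissonIntegral hr.1 hr.2 hlog
    rw [intervalIntegrable_iff] at this hint
    exact hint.1.mul (Real.continuous_exp.comp_aestronglyMeasurable this.1.neg)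
  · filter_upwards [eventually_mem_Ico_nhdsLT_one] with r hr
    refine ae_of_all _ fun l _ => ?_
    rw [norm_mul, Real.norm_eq_abs, Real.norm_eq_abs, Real.abs_exp]
    have := log_le_poissonIntegral_log hint hδ hlow hr.1 hr.2 l
    gcongr
  · rw [Set.uIoc_of_le hle, ← ae_restrict_iff' measurableSet_Ioc]
    filter_upwards [ae_tendsto_poissonIntegral_log hint hδ hlow hcont, ae_sin_ne_zero] with l h1 h2
    have h3 := ((Real.continuous_exp.tendsto _).comp h1.neg).const_mul (f l)
    rw [Real.exp_neg, Real.exp_log (hδ.trans_le (hlow l h2)),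
      mul_inv_cancel₀ (hδ.trans_le (hlow l h2)).ne'] at h3
    exact h3

/-- Scheffé's argument. With `g_r = exp(P_r log f)`, `∫ |g_r - f| = 2 ∫ (f - g_r)⁺ + ∫ g_r - ∫ f`.
The positive part is dominated by `|f|` and tends to 0 almost everywhere, and `∫ g_r ≤ ∫ P_r f = ∫
f` by Jensen. -/
theorem tendsto_integral_abs_exp_poissonIntegral_sub
    (hint : IntervalIntegrable f volume (-Real.pi) Real.pi)
    (hδ : 0 < δ) (hlow : ∀ l, Real.sin l ≠ 0 → δ ≤ f l)
    (hcont : ∀ l, Real.sin l ≠ 0 → ContinuousAt f l) :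
    Tendsto (fun r => ∫ l in (-Real.pi)..Real.pi,
      |Real.exp (poissonIntegral (fun l => Real.log (f l)) r l) - f l|) (𝓝[<] 1) (𝓝 0) := by
  have hp := Real.pi_pos
  have hle : -Real.pi ≤ Real.pi := by linarith
  have hlog := intervalIntegrable_log_of_le hint hδ hlow
  have hpos : Tendsto (fun r => ∫ l in (-Real.pi)..Real.pi,
      max (f l - Real.exp (poissonIntegral (fun l => Real.log (f l)) r l)) 0) (𝓝[<] 1)
      (𝓝 (∫ l in (-Real.pi)..Real.pi, (0 : ℝ))) := by
    refine intervalIntegral.tendsto_integral_filter_of_dominated_convergence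
      (fun l => |f l|) ?_ ?_ hint.abs ?_
    · filter_upwards [eventually_mem_Ico_nhdsLT_one] with r hr
      have :=
        hint.sub (intervalIntegrable_exp_poissonIntegral hint hδ hlow hr.1 hr.2)
      rw [intervalIntegrable_iff] at this
      exact this.1.sup aestronglyMeasurable_const
    · refine Eventually.of_forall fun r => ae_of_all _ fun l _ => ?_
      rw [Real.norm_of_nonneg (le_max_right _ _)]
      refine max_le ?_ (abs_nonneg _)
      linarith [le_abs_self (f l), Real.exp_pos (poissonIntegral (fun l => Real.log (f l)) r l)]
    · rw [Set.uIoc_of_le hle, ← ae_restrict_iff' measurableSet_Ioc]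
      filter_upwards [ae_tendsto_poissonIntegral_log hint hδ hlow hcont, ae_sin_ne_zero]
        with l h1 h2
      have h3 := (Real.continuous_exp.tendsto _).comp h1
      rw [Real.exp_log (hδ.trans_le (hlow l h2))] at h3
      have h4 := (h3.const_sub (f l)).max (tendsto_const_nhds (x := (0 : ℝ)))
      simpa using h4
  rw [intervalIntegral.integral_zero] at hpos
  refine squeeze_zero' (Eventually.of_forall fun r =>
    intervalIntegral.integral_nonneg hle fun l _ => abs_nonneg _) ?_
    (by simpa using hpos.const_mul 2)
  filter_upwards [eventually_mem_Ico_nhdsLT_one] with r hr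
  have hE := intervalIntegrable_exp_poissonIntegral hint hδ hlow hr.1 hr.2
  have hD := hint.sub hE
  have hM : IntervalIntegrable (fun l =>
      max (f l - Real.exp (poissonIntegral (fun l => Real.log (f l)) r l)) 0) volume
      (-Real.pi) Real.pi := ⟨hD.1.pos_part, hD.2.pos_part⟩
  have habs : ∀ l, |Real.exp (poissonIntegral (fun l => Real.log (f l)) r l) - f l| =
      2 * max (f l - Real.exp (poissonIntegral (fun l => Real.log (f l)) r l)) 0 +
        (Real.exp (poissonIntegral (fun l => Real.log (f l)) r l) - f l) := by
    intro l
    rcases le_total (f l) (Real.exp (poissonIntegral (fun l => Real.log (f l)) r l)) with h | h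
    · rw [abs_of_nonneg (by linarith), max_eq_right (by linarith)]; ring
    · rw [abs_of_nonpos (by linarith), max_eq_left (by linarith)]; ring
  simp_rw [habs]
  rw [intervalIntegral.integral_add (hM.const_mul 2) (hE.sub hint),
    intervalIntegral.integral_const_mul, intervalIntegral.integral_sub hE hint]
  have : ∫ l in (-Real.pi)..Real.pi, Real.exp (poissonIntegral (fun l => Real.log (f l)) r l) ≤
      ∫ l in (-Real.pi)..Real.pi, f l := by
    rw [← integral_poissonIntegral hr.1 hr.2 hint]
    exact intervalIntegral.integral_mono_on hle hE
      (intervalIntegrable_poissonIntegral hr.1 hr.2 hint)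
      fun l _ => exp_poissonIntegral_log_le hint hδ hlow hr.1 hr.2 l
  linarith

end LogIntegrable

/-! ### The outer function and its Taylor coefficients. -/

/-- Averaging the expansion at `z` with the conjugate of the expansion at the conjugate of `z`
replaces each coefficient by its real part. -/
theorem exists_real_taylor {F : ℂ → ℂ} (hF : DifferentiableOn ℂ F (Metric.ball 0 1))
    (hsymm : ∀ z, ‖z‖ < 1 → F ((starRingEnd ℂ) z) = (starRingEnd ℂ) (F z)) :
    ∃ c : ℕ → ℝ, ∀ z : ℂ, ‖z‖ < 1 → HasSum (fun j : ℕ => (c j : ℂ) * z ^ j) (F z) := by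
  set α : ℕ → ℂ := fun n => (n.factorial : ℂ)⁻¹ * iteratedDeriv n F 0 with hα
  have hsum : ∀ z : ℂ, ‖z‖ < 1 → HasSum (fun j : ℕ => α j * z ^ j) (F z) := by
    intro z hz
    have := Complex.hasSum_taylorSeries_on_ball hF (by simpa using hz : z ∈ Metric.ball (0 : ℂ) 1)
    refine this.congr_fun fun n => ?_
    simp only [hα, smul_eq_mul, sub_zero]
    ring
  refine ⟨fun n => (α n).re, fun z hz => ?_⟩
  have h1 := hsum z hz
  have h2 : HasSum (fun j : ℕ => (starRingEnd ℂ) (α j * (starRingEnd ℂ) z ^ j))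
      ((starRingEnd ℂ) (F ((starRingEnd ℂ) z))) :=
    Complex.hasSum_conj'.2 (hsum _ (by rwa [RCLike.norm_conj]))
  rw [hsymm z hz, Complex.conj_conj] at h2
  have h3 := (h1.add h2).mul_left (1 / 2)
  rw [show (1 / 2 : ℂ) * (F z + F z) = F z by ring] at h3
  refine h3.congr_fun fun n => ?_
  rw [map_mul, map_pow, Complex.conj_conj, ← add_mul, Complex.re_eq_add_conj]
  ring

section Outer

variable {f : ℝ → ℝ}

theorem one_sub_norm_le_norm_exp_sub (z : ℂ) (l : ℝ) :
    1 - ‖z‖ ≤ ‖Complex.exp (Complex.I * l) - z‖ := by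
  have := norm_sub_norm_le (Complex.exp (Complex.I * l)) z
  rwa [norm_exp_I_mul] at this

theorem exp_sub_ne_zero {z : ℂ} (hz : ‖z‖ < 1) (l : ℝ) : Complex.exp (Complex.I * l) - z ≠ 0 :=
  norm_pos_iff.1 (lt_of_lt_of_le (by linarith) (one_sub_norm_le_norm_exp_sub z l))

theorem continuous_herglotz {z : ℂ} (hz : ‖z‖ < 1) : Continuous fun l : ℝ =>
    (Complex.exp (Complex.I * l) + z) / (Complex.exp (Complex.I * l) - z) :=
  Continuous.div (by fun_prop) (by fun_prop) (exp_sub_ne_zero hz)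

theorem intervalIntegrable_herglotz_mul
    (hlog : IntervalIntegrable (fun l => Real.log (f l)) volume (-Real.pi) Real.pi)
    {z : ℂ} (hz : ‖z‖ < 1) : IntervalIntegrable (fun l : ℝ =>
      (Complex.exp (Complex.I * l) + z) / (Complex.exp (Complex.I * l) - z) *
        (Real.log (f l) : ℂ)) volume (-Real.pi) Real.pi :=
  IntervalIntegrable.continuousOn_mul ⟨hlog.1.ofReal, hlog.2.ofReal⟩
    (continuous_herglotz hz).continuousOn

theorem differentiableOn_outerFunction
    (hlog : IntervalIntegrable (fun l => Real.log (f l)) volume (-Real.pi) Real.pi) :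
    DifferentiableOn ℂ (outerFunction f) (Metric.ball 0 1) := by
  intro z₀ hz₀
  have hz₀' : ‖z₀‖ < 1 := by simpa using hz₀
  refine DifferentiableAt.differentiableWithinAt ?_
  have hlogC : IntervalIntegrable (fun l => (Real.log (f l) : ℂ)) volume (-Real.pi) Real.pi :=
    ⟨hlog.1.ofReal, hlog.2.ofReal⟩
  -- Half the distance to the unit circle: on the ball of this radius `|e^{il} - z| ≥ η`, which
  -- bounds the derivative of the kernel.
  set η := (1 - ‖z₀‖) / 2 with hη
  have hη0 : 0 < η := by linarith
  have hball : ∀ z ∈ Metric.ball z₀ η, ‖z‖ < 1 - η := by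
    intro z hz
    have h1 : ‖z - z₀‖ < η := by simpa [dist_eq_norm] using hz
    have h2 := norm_add_le z₀ (z - z₀)
    rw [add_sub_cancel] at h2
    linarith
  have key := (intervalIntegral.hasDerivAt_integral_of_dominated_loc_of_deriv_le
    (μ := volume) (a := -Real.pi) (b := Real.pi) (𝕜 := ℂ)
    (F := fun z (l : ℝ) => (Complex.exp (Complex.I * l) + z) / (Complex.exp (Complex.I * l) - z) *
        (Real.log (f l) : ℂ))
    (F' := fun z (l : ℝ) => 2 * Complex.exp (Complex.I * l) /
      (Complex.exp (Complex.I * l) - z) ^ 2 * (Real.log (f l) : ℂ))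
    (bound := fun l => 2 / η ^ 2 * |Real.log (f l)|) (x₀ := z₀) (Metric.ball_mem_nhds z₀ hη0)
    ?_ (intervalIntegrable_herglotz_mul hlog hz₀') ?_ ?_ (hlog.abs.const_mul _) ?_).2
  · unfold outerFunction
    exact (key.differentiableAt.const_mul _).cexp
  · filter_upwards [Metric.ball_mem_nhds z₀ hη0] with z hz
    have := intervalIntegrable_herglotz_mul hlog (z := z) (by linarith [hball z hz])
    rw [intervalIntegrable_iff] at this
    exact this.1
  · have : IntervalIntegrable (fun l : ℝ => 2 * Complex.exp (Complex.I * l) /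
      (Complex.exp (Complex.I * l) - z₀) ^ 2 * (Real.log (f l) : ℂ)) volume
        (-Real.pi) Real.pi :=
      hlogC.continuousOn_mul (Continuous.div (by fun_prop) (by fun_prop)
        fun l => pow_ne_zero 2 (exp_sub_ne_zero hz₀' l)).continuousOn
    rw [intervalIntegrable_iff] at this
    exact this.1
  · refine ae_of_all _ fun l _ z hz => ?_
    have h1 : η ≤ ‖Complex.exp (Complex.I * l) - z‖ := by
      linarith [one_sub_norm_le_norm_exp_sub z l, hball z hz]
    rw [norm_mul, norm_div, norm_mul, norm_pow, norm_exp_I_mul, Complex.norm_real,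
      Real.norm_eq_abs, Complex.norm_ofNat, mul_one]
    gcongr
  · refine ae_of_all _ fun l _ z hz => ?_
    have h0 := exp_sub_ne_zero (z := z) (by linarith [hball z hz]) l
    have h1 : HasDerivAt (fun z : ℂ => Complex.exp (Complex.I * l) + z) 1 z :=
      (hasDerivAt_id z).const_add _
    have h2 : HasDerivAt (fun z : ℂ => Complex.exp (Complex.I * l) - z) (-1) z :=
      (hasDerivAt_id z).const_sub _
    have h3 := (h1.div h2 h0).mul_const (Real.log (f l) : ℂ)
    have h4 : (1 * (Complex.exp (Complex.I * l) - z) - (Complex.exp (Complex.I * l) + z) * -1) /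
        (Complex.exp (Complex.I * l) - z) ^ 2 =
        2 * Complex.exp (Complex.I * l) / (Complex.exp (Complex.I * l) - z) ^ 2 := by
      congr 1; ring
    rw [h4] at h3
    exact h3

theorem outerFunction_ne_zero (f : ℝ → ℝ) (z : ℂ) : outerFunction f z ≠ 0 := Complex.exp_ne_zero _

theorem outerFunction_conj (hev : ∀ l, f (-l) = f l) (z : ℂ) :
    outerFunction f ((starRingEnd ℂ) z) = (starRingEnd ℂ) (outerFunction f z) := by
  unfold outerFunction
  have hle : -Real.pi ≤ Real.pi := by linarith [Real.pi_pos]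
  rw [← Complex.exp_conj, map_mul, intervalIntegral.integral_of_le hle (f := fun l : ℝ =>
    (Complex.exp (Complex.I * l) + z) / (Complex.exp (Complex.I * l) - z) * (Real.log (f l) : ℂ)),
    ← integral_conj, ← intervalIntegral.integral_of_le hle]
  have := intervalIntegral.integral_comp_neg (a := -Real.pi) (b := Real.pi) (fun l : ℝ =>
    (Complex.exp (Complex.I * l) + (starRingEnd ℂ) z) /
      (Complex.exp (Complex.I * l) - (starRingEnd ℂ) z) * (Real.log (f l) : ℂ))
  rw [neg_neg] at this
  rw [← this]
  congr 2
  · rw [map_div₀, map_mul, map_one, Complex.conj_ofReal, Complex.conj_ofNat]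
  · congr 1
    ext l
    simp [← Complex.exp_conj, hev]

/-- The real part of the Herglotz kernel is the Poisson kernel. Squaring the modulus doubles the
exponent and turns `1 / (4π)` into `1 / (2π)`. -/
theorem norm_sq_outerFunction
    (hlog : IntervalIntegrable (fun l => Real.log (f l)) volume (-Real.pi) Real.pi)
    {r : ℝ} (hr : 0 ≤ r) (hr1 : r < 1) (l : ℝ) :
    ‖outerFunction f (r * Complex.exp (Complex.I * l))‖ ^ 2 =
      Real.exp (poissonIntegral (fun l => Real.log (f l)) r l) := by
  have hz : ‖(r : ℂ) * Complex.exp (Complex.I * l)‖ < 1 := by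
    rwa [norm_mul, norm_exp_I_mul, mul_one, Complex.norm_real, Real.norm_of_nonneg hr]
  have hre : ∀ θ : ℝ, ((Complex.exp (Complex.I * θ) + r * Complex.exp (Complex.I * l)) /
      (Complex.exp (Complex.I * θ) - r * Complex.exp (Complex.I * l)) *
        (Real.log (f θ) : ℂ)).re = poisson r l θ * Real.log (f θ) := by
    intro θ
    have h1 := congrFun (poissonKernel_eq_re_herglotzRieszKernel (c := 0)
      (w := r * Complex.exp (Complex.I * l))) (Complex.exp (Complex.I * θ))
    simp only [poissonKernel, Function.comp_apply,
      herglotzRieszKernel, sub_zero] at h1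
    have h2 : Complex.exp (Complex.I * θ) - r * Complex.exp (Complex.I * l) =
        Complex.exp (Complex.I * θ) * (1 - r * Complex.exp (Complex.I * ((l - θ : ℝ) : ℂ))) := by
      rw [mul_sub, mul_left_comm, ← Complex.exp_add]
      push_cast; ring_nf
    have h3 : ‖Complex.exp (Complex.I * θ) - r * Complex.exp (Complex.I * l)‖ ^ 2 =
        1 - 2 * r * Real.cos (θ - l) + r ^ 2 := by
      rw [h2, norm_mul, norm_exp_I_mul, one_mul, norm_one_sub_mul_exp_sq, ← Real.cos_neg, neg_sub]
    rw [Complex.re_mul_ofReal, ← h1, h3, norm_mul, norm_exp_I_mul, norm_exp_I_mul, mul_one,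
      Complex.norm_real, Real.norm_of_nonneg hr, poisson]
    ring
  have hI : (∫ θ in (-Real.pi)..Real.pi,
      (Complex.exp (Complex.I * θ) + r * Complex.exp (Complex.I * l)) /
      (Complex.exp (Complex.I * θ) - r * Complex.exp (Complex.I * l)) *
        (Real.log (f θ) : ℂ)).re =
      ∫ θ in (-Real.pi)..Real.pi, poisson r l θ * Real.log (f θ) := by
    rw [← Complex.reCLM_apply, ← ContinuousLinearMap.intervalIntegral_comp_comm _
      (intervalIntegrable_herglotz_mul hlog hz)]
    simp_rw [Complex.reCLM_apply, hre]
  rw [outerFunction, Complex.norm_exp, ← Real.exp_nat_mul]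
  congr 1
  have h4 : (1 / (4 * Real.pi) : ℂ) = ((1 / (4 * Real.pi) : ℝ) : ℂ) := by push_cast; rfl
  rw [h4, Complex.re_ofReal_mul, hI, poissonIntegral]
  have := Real.pi_pos
  push_cast
  field_simp
  norm_num

theorem innovationVariance_eq
    (hlog : IntervalIntegrable (fun l => Real.log (f l)) volume (-Real.pi) Real.pi) :
    innovationVariance f = 2 * Real.pi * ‖outerFunction f 0‖ ^ 2 := by
  have := norm_sq_outerFunction hlog le_rfl one_pos 0
  simp only [Complex.ofReal_zero, zero_mul] at this
  rw [this, innovationVariance, poissonIntegral]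
  simp [poisson]

theorem innovationVariance_pos (f : ℝ → ℝ) : 0 < innovationVariance f :=
  mul_pos (by linarith [Real.pi_pos]) (Real.exp_pos _)

theorem exists_taylor_outerFunction (hev : ∀ l, f (-l) = f l)
    (hlog : IntervalIntegrable (fun l => Real.log (f l)) volume (-Real.pi) Real.pi) :
    ∃ c : ℕ → ℝ, ∀ z : ℂ, ‖z‖ < 1 →
      HasSum (fun j : ℕ => (c j : ℂ) * z ^ j) (outerFunction f z / outerFunction f 0) := by
  refine exists_real_taylor ((differentiableOn_outerFunction hlog).div_const _) fun z _ => ?_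
  rw [map_div₀, outerFunction_conj hev]
  congr 1
  simpa using outerFunction_conj hev 0

/-- The outer function has no zeros, so its reciprocal is analytic too. These coefficients invert
the moving average. -/
theorem exists_taylor_inv_outerFunction (hev : ∀ l, f (-l) = f l)
    (hlog : IntervalIntegrable (fun l => Real.log (f l)) volume (-Real.pi) Real.pi) :
    ∃ b : ℕ → ℝ, ∀ z : ℂ, ‖z‖ < 1 →
      HasSum (fun j : ℕ => (b j : ℂ) * z ^ j) (outerFunction f 0 / outerFunction f z) := by
  refine exists_real_taylor ((differentiableOn_const _).div (differentiableOn_outerFunction hlog)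
    fun z _ => outerFunction_ne_zero f z) fun z _ => ?_
  rw [map_div₀, outerFunction_conj hev]
  congr 1
  simpa using outerFunction_conj hev 0

theorem coeff_zero_eq_one {c : ℕ → ℝ} {F : ℂ → ℂ} (hF : F 0 = 1)
    (hc : ∀ z : ℂ, ‖z‖ < 1 → HasSum (fun j : ℕ => (c j : ℂ) * z ^ j) (F z)) : c 0 = 1 := by
  have h := hc 0 (by simp)
  rw [hF] at h
  have h2 := hasSum_single (f := fun j : ℕ => (c j : ℂ) * 0 ^ j) 0 (fun j hj => by simp [hj])
  simpa using h2.unique h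

theorem summable_abs_mul_pow {c : ℕ → ℝ} {F : ℂ → ℂ}
    (hc : ∀ z : ℂ, ‖z‖ < 1 → HasSum (fun j : ℕ => (c j : ℂ) * z ^ j) (F z)) {r : ℝ} (hr : 0 ≤ r)
    (hr1 : r < 1) : Summable fun j => |c j * r ^ j| := by
  have := (hc r (by rwa [Complex.norm_real, Real.norm_of_nonneg hr])).summable.norm
  refine this.congr fun j => ?_
  rw [← Complex.ofReal_pow, ← Complex.ofReal_mul, Complex.norm_real, Real.norm_eq_abs]

theorem hasSum_mul_pow_exp {c : ℕ → ℝ} {F : ℂ → ℂ}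
    (hc : ∀ z : ℂ, ‖z‖ < 1 → HasSum (fun j : ℕ => (c j : ℂ) * z ^ j) (F z)) {r : ℝ} (hr : 0 ≤ r)
    (hr1 : r < 1) (l : ℝ) : HasSum (fun j : ℕ => ((c j * r ^ j : ℝ) : ℂ) *
      Complex.exp (Complex.I * l) ^ j) (F (r * Complex.exp (Complex.I * l))) := by
  refine (hc _ ?_).congr_fun fun j => ?_
  · rwa [norm_mul, norm_exp_I_mul, mul_one, Complex.norm_real, Real.norm_of_nonneg hr]
  · push_cast; ring

theorem integral_exp_mul_exp_poissonIntegral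
    (hlog : IntervalIntegrable (fun l => Real.log (f l)) volume (-Real.pi) Real.pi) {c : ℕ → ℝ}
    (hc : ∀ z : ℂ, ‖z‖ < 1 →
      HasSum (fun j : ℕ => (c j : ℂ) * z ^ j) (outerFunction f z / outerFunction f 0))
    {r : ℝ} (hr : 0 ≤ r) (hr1 : r < 1) (h : ℕ) :
    ∫ l in (-Real.pi)..Real.pi, Complex.exp (Complex.I * h * l) *
      (Real.exp (poissonIntegral (fun l => Real.log (f l)) r l) : ℂ) =
      ((innovationVariance f * ∑' k, (c k * r ^ k) * (c (k + h) * r ^ (k + h)) : ℝ) : ℂ) := by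
  have hp := integral_exp_mul_norm_sq_of_hasSum (summable_abs_mul_pow hc hr hr1)
    (hasSum_mul_pow_exp hc hr hr1) h
  simp_rw [norm_div, div_pow, norm_sq_outerFunction hlog hr hr1] at hp
  have h0 : (‖outerFunction f 0‖ ^ 2 : ℝ) ≠ 0 :=
    pow_ne_zero 2 (norm_ne_zero_iff.2 (outerFunction_ne_zero f 0))
  rw [innovationVariance_eq hlog]
  have : ∀ l : ℝ, Complex.exp (Complex.I * h * l) *
      (Real.exp (poissonIntegral (fun l => Real.log (f l)) r l) : ℂ) =
      ((‖outerFunction f 0‖ ^ 2 : ℝ) : ℂ) * (Complex.exp (Complex.I * h * l) *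
      ((Real.exp (poissonIntegral (fun l => Real.log (f l)) r l) /
        ‖outerFunction f 0‖ ^ 2 : ℝ) : ℂ)) := by
    intro l
    rw [mul_left_comm, ← Complex.ofReal_mul, mul_div_cancel₀ _ h0]
  simp_rw [this]
  rw [intervalIntegral.integral_const_mul, hp]
  push_cast
  ring

variable {δ : ℝ}

theorem tendsto_integral_exp_mul_exp_poissonIntegral
    (hint : IntervalIntegrable f volume (-Real.pi) Real.pi)
    (hδ : 0 < δ) (hlow : ∀ l, Real.sin l ≠ 0 → δ ≤ f l)
    (hcont : ∀ l, Real.sin l ≠ 0 → ContinuousAt f l) (h : ℕ) :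
    Tendsto (fun r => ∫ l in (-Real.pi)..Real.pi, Complex.exp (Complex.I * h * l) *
      (Real.exp (poissonIntegral (fun l => Real.log (f l)) r l) : ℂ)) (𝓝[<] 1)
      (𝓝 (∫ l in (-Real.pi)..Real.pi, Complex.exp (Complex.I * h * l) * (f l : ℂ))) := by
  have hp := Real.pi_pos
  have hle : -Real.pi ≤ Real.pi := by linarith
  have hlog := intervalIntegrable_log_of_le hint hδ hlow
  have h0 := tendsto_integral_abs_exp_poissonIntegral_sub hint hδ hlow hcont
  rw [tendsto_iff_norm_sub_tendsto_zero]
  refine squeeze_zero' (Eventually.of_forall fun r => norm_nonneg _) ?_ h0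
  filter_upwards [eventually_mem_Ico_nhdsLT_one] with r hr
  have hcontexp : ContinuousOn (fun l : ℝ => Complex.exp (Complex.I * h * l))
      (Set.uIcc (-Real.pi) Real.pi) := by fun_prop
  have hfC : IntervalIntegrable (fun l => (f l : ℂ)) volume (-Real.pi) Real.pi :=
    ⟨hint.1.ofReal, hint.2.ofReal⟩
  have hE := intervalIntegrable_exp_poissonIntegral hint hδ hlow hr.1 hr.2
  have hEC : IntervalIntegrable (fun l =>
      (Real.exp (poissonIntegral (fun l => Real.log (f l)) r l) : ℂ)) volume
      (-Real.pi) Real.pi := ⟨hE.1.ofReal, hE.2.ofReal⟩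
  rw [← intervalIntegral.integral_sub (hEC.continuousOn_mul hcontexp)
    (hfC.continuousOn_mul hcontexp)]
  refine (intervalIntegral.norm_integral_le_integral_norm hle).trans (le_of_eq ?_)
  refine intervalIntegral.integral_congr fun l _ => ?_
  rw [← mul_sub, norm_mul, ← Complex.ofReal_sub, Complex.norm_real, Real.norm_eq_abs]
  have := norm_exp_I_mul (h * l)
  push_cast at this
  rw [mul_assoc, this, one_mul]

/-- By Parseval on the circle of radius `r`, `∑ (c k * r ^ k) ^ 2` is the integral of `exp(P_r log
f)` over `σ²`, hence at most `∫ f / σ²`. Then `r ↑ 1` in finite partial sums. -/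
theorem summable_sq_taylor_outerFunction
    (hint : IntervalIntegrable f volume (-Real.pi) Real.pi)
    (hδ : 0 < δ) (hlow : ∀ l, Real.sin l ≠ 0 → δ ≤ f l) {c : ℕ → ℝ}
    (hc : ∀ z : ℂ, ‖z‖ < 1 →
      HasSum (fun j : ℕ => (c j : ℂ) * z ^ j) (outerFunction f z / outerFunction f 0)) :
    Summable fun j => c j ^ 2 := by
  have hlog := intervalIntegrable_log_of_le hint hδ hlow
  have hv := innovationVariance_pos f
  refine summable_of_sum_range_le (c := (innovationVariance f)⁻¹ *
    ∫ l in (-Real.pi)..Real.pi, f l) (fun _ => sq_nonneg _) fun n => ?_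
  have hle : ∀ᶠ r : ℝ in 𝓝[<] 1, ∑ j ∈ Finset.range n, (c j * r ^ j) ^ 2 ≤
      (innovationVariance f)⁻¹ * ∫ l in (-Real.pi)..Real.pi, f l := by
    filter_upwards [eventually_mem_Ico_nhdsLT_one] with r hr
    have h1 := integral_exp_mul_exp_poissonIntegral hlog hc hr.1 hr.2 0
    simp only [Nat.cast_zero, mul_zero, zero_mul, Complex.exp_zero, one_mul, add_zero] at h1
    rw [intervalIntegral.integral_ofReal, Complex.ofReal_inj] at h1
    have hs : Summable fun k => (c k * r ^ k) * (c k * r ^ k) := by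
      have := summable_abs_mul_pow hc hr.1 hr.2
      -- Terms of an absolutely convergent series are eventually at most 1, and then bound their
      -- squares.
      refine Summable.of_norm_bounded_eventually_nat this ?_
      filter_upwards [this.tendsto_atTop_zero.eventually_le_const one_pos] with k hk
      rw [norm_mul, Real.norm_eq_abs]
      exact mul_le_of_le_one_left (abs_nonneg _) hk
    calc ∑ j ∈ Finset.range n, (c j * r ^ j) ^ 2
        ≤ ∑' k, (c k * r ^ k) * (c k * r ^ k) := by
          simp_rw [sq]
          exact hs.sum_le_tsum _ fun k _ => mul_self_nonneg _
      _ = (innovationVariance f)⁻¹ * ∫ l in (-Real.pi)..Real.pi,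
          Real.exp (poissonIntegral (fun l => Real.log (f l)) r l) := by
          rw [h1, inv_mul_cancel_left₀ hv.ne']
      _ ≤ _ := by
          refine mul_le_mul_of_nonneg_left ?_ (inv_nonneg.2 hv.le)
          rw [← integral_poissonIntegral hr.1 hr.2 hint]
          exact intervalIntegral.integral_mono_on (by linarith [Real.pi_pos])
            (intervalIntegrable_exp_poissonIntegral hint hδ hlow hr.1 hr.2)
            (intervalIntegrable_poissonIntegral hr.1 hr.2 hint)
            fun l _ => exp_poissonIntegral_log_le hint hδ hlow hr.1 hr.2 l
  have hlim : Tendsto (fun r : ℝ => ∑ j ∈ Finset.range n, (c j * r ^ j) ^ 2) (𝓝[<] 1)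
      (𝓝 (∑ j ∈ Finset.range n, c j ^ 2)) := by
    have : ContinuousAt (fun r : ℝ => ∑ j ∈ Finset.range n, (c j * r ^ j) ^ 2) 1 := by fun_prop
    simpa using this.tendsto.mono_left (nhdsWithin_le_nhds (s := Set.Iio 1))
  exact le_of_tendsto hlim hle

/-- The limit `r ↑ 1` of the identity on the circle of radius `r`: L¹ convergence on the frequency
side, dominated convergence on the coefficient side. -/
theorem innovationVariance_mul_tsum
    (hint : IntervalIntegrable f volume (-Real.pi) Real.pi)
    (hδ : 0 < δ) (hlow : ∀ l, Real.sin l ≠ 0 → δ ≤ f l)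
    (hcont : ∀ l, Real.sin l ≠ 0 → ContinuousAt f l) {c : ℕ → ℝ}
    (hc : ∀ z : ℂ, ‖z‖ < 1 →
      HasSum (fun j : ℕ => (c j : ℂ) * z ^ j) (outerFunction f z / outerFunction f 0)) (h : ℕ) :
    ((innovationVariance f * ∑' k, c k * c (k + h) : ℝ) : ℂ) =
      ∫ l in (-Real.pi)..Real.pi, Complex.exp (Complex.I * h * l) * (f l : ℂ) := by
  have hlog := intervalIntegrable_log_of_le hint hδ hlow
  have hsq := summable_sq_taylor_outerFunction hint hδ hlow hc
  refine tendsto_nhds_unique ?_ (tendsto_integral_exp_mul_exp_poissonIntegral hint hδ hlow hcont h)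
  have hT : Tendsto (fun r : ℝ => ∑' k, (c k * r ^ k) * (c (k + h) * r ^ (k + h))) (𝓝[<] 1)
      (𝓝 (∑' k, c k * c (k + h))) := by
    refine tendsto_tsum_of_dominated_convergence (bound := fun k => c k ^ 2 + c (k + h) ^ 2)
      (hsq.add ((summable_nat_add_iff h).2 hsq)) (fun k => ?_) ?_
    · have : ContinuousAt (fun r : ℝ => (c k * r ^ k) * (c (k + h) * r ^ (k + h))) 1 := by fun_prop
      simpa using this.tendsto.mono_left (nhdsWithin_le_nhds (s := Set.Iio 1))
    · filter_upwards [eventually_mem_Ico_nhdsLT_one] with r hr k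
      rw [show (c k * r ^ k) * (c (k + h) * r ^ (k + h)) =
        (c k * c (k + h)) * r ^ (k + (k + h)) by ring, norm_mul, norm_pow,
        Real.norm_of_nonneg hr.1]
      refine (mul_le_of_le_one_right (norm_nonneg _) (pow_le_one₀ hr.1 hr.2.le)).trans ?_
      rw [Real.norm_eq_abs, abs_le]
      constructor <;> nlinarith [sq_nonneg (c k + c (k + h)), sq_nonneg (c k - c (k + h)),
        sq_nonneg (c k), sq_nonneg (c (k + h))]
  refine ((Complex.continuous_ofReal.tendsto _).comp
    (hT.const_mul (innovationVariance f))).congr' ?_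
  filter_upwards [eventually_mem_Ico_nhdsLT_one] with r hr
  exact (integral_exp_mul_exp_poissonIntegral hlog hc hr.1 hr.2 h).symm

/-- The integrand is `|h(0)|² f exp(-P_r log f)`, and the integral of `f exp(-P_r log f)` tends to
`2π`. This is the norm computation behind `single_sub_maVector_mem`. -/
theorem tendsto_integral_norm_sq_inv_outerFunction
    (hint : IntervalIntegrable f volume (-Real.pi) Real.pi)
    (hδ : 0 < δ) (hlow : ∀ l, Real.sin l ≠ 0 → δ ≤ f l)
    (hcont : ∀ l, Real.sin l ≠ 0 → ContinuousAt f l) :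
    Tendsto (fun r : ℝ => ∫ l in (-Real.pi)..Real.pi,
      ‖outerFunction f 0 / outerFunction f (r * Complex.exp (Complex.I * l))‖ ^ 2 * f l) (𝓝[<] 1)
      (𝓝 (innovationVariance f)) := by
  have hlog := intervalIntegrable_log_of_le hint hδ hlow
  have := (tendsto_integral_mul_exp_neg_poissonIntegral hint hδ hlow hcont).const_mul
    (‖outerFunction f 0‖ ^ 2)
  rw [mul_comm, ← innovationVariance_eq hlog] at this
  refine this.congr' ?_
  filter_upwards [eventually_mem_Ico_nhdsLT_one] with r hr
  rw [← intervalIntegral.integral_const_mul]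
  refine intervalIntegral.integral_congr fun l _ => ?_
  rw [norm_div, div_pow, norm_sq_outerFunction hlog hr.1 hr.2, Real.exp_neg]
  ring

end Outer

/-! ### A scaled isometry from proportional Gram matrices. -/

section Gram

variable {K H : Type*} [NormedAddCommGroup K] [InnerProductSpace ℝ K]
  [NormedAddCommGroup H] [InnerProductSpace ℝ H] [CompleteSpace H]

/-- On finite linear combinations the Gram identity bounds the image norm by `√κ` times the source
norm. The map is therefore well defined on the span of the `x t` and extends by density. -/
theorem exists_continuousLinearMap_of_inner_eq {ι : Type*} {x : ι → K} {X : ι → H} {κ : ℝ}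
    (hκ : 0 ≤ κ) (hd : (Submodule.span ℝ (Set.range x)).topologicalClosure = ⊤)
    (hin : ∀ s t, inner ℝ (X s) (X t) = κ * inner ℝ (x s) (x t)) :
    ∃ V : K →L[ℝ] H, (∀ t, V (x t) = X t) ∧
      ∀ u w, inner ℝ (V u) (V w) = κ * inner ℝ u w := by
  set e := Finsupp.linearCombination ℝ x with he
  set g := Finsupp.linearCombination ℝ X with hg
  have hdense : DenseRange e := by
    have : Dense ((Submodule.span ℝ (Set.range x) : Submodule ℝ K) : Set K) := by
      rw [Submodule.dense_iff_topologicalClosure_eq_top, hd]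
    rwa [← Finsupp.range_linearCombination] at this
  have hgram : ∀ a b, inner ℝ (g a) (g b) = κ * inner ℝ (e a) (e b) := by
    intro a b
    simp only [hg, he, Finsupp.linearCombination_apply, Finsupp.sum, sum_inner, inner_sum,
      real_inner_smul_left, real_inner_smul_right, hin, Finset.mul_sum]
    refine Finset.sum_congr rfl fun i _ => Finset.sum_congr rfl fun j _ => by ring
  have hbound : ∀ a, ‖g a‖ ≤ Real.sqrt κ * ‖e a‖ := by
    intro a
    have h := hgram a a
    rw [real_inner_self_eq_norm_sq, real_inner_self_eq_norm_sq] at h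
    rw [← Real.sqrt_sq (norm_nonneg (g a)), h, Real.sqrt_mul hκ, Real.sqrt_sq (norm_nonneg _)]
  set V := g.extendOfNorm e with hV
  have hVe : ∀ a, V (e a) = g a := LinearMap.extendOfNorm_eq hdense ⟨_, hbound⟩
  refine ⟨V, fun t => ?_, fun u w => ?_⟩
  · have := hVe (Finsupp.single t 1)
    simpa [he, hg] using this
  · refine hdense.induction_on₂ (p := fun u w => inner ℝ (V u) (V w) = κ * inner ℝ u w) ?_ ?_ u w
    · exact isClosed_eq (by fun_prop) (by fun_prop)
    · intro a b
      rw [hVe, hVe, hgram]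

end Gram

/-! ### Norms of linear combinations as spectral integrals. -/

section SpectralNorm

variable {K : Type*} [NormedAddCommGroup K] [InnerProductSpace ℝ K] {f : ℝ → ℝ} {x : ℤ → K}
  {κ : ℝ}

/-- The spectral isometry: `x (t - j)` corresponds to `e^{ijl}` in L² of the measure `f(l) dl`, up
to the factor `κ`. -/
theorem norm_sq_sum_eq_integral (hint : IntervalIntegrable f volume (-Real.pi) Real.pi)
    (hx : ∀ s t : ℤ, ((κ * inner ℝ (x s) (x t) : ℝ) : ℂ) =
      ∫ l in (-Real.pi)..Real.pi, Complex.exp (Complex.I * ((s - t : ℤ) : ℂ) * l) * (f l : ℂ))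
    (t : ℤ) (a : ℕ → ℝ) (n : ℕ) :
    κ * ‖∑ j ∈ Finset.range n, a j • x (t - j)‖ ^ 2 = ∫ l in (-Real.pi)..Real.pi,
      ‖∑ j ∈ Finset.range n, (a j : ℂ) * Complex.exp (Complex.I * l) ^ j‖ ^ 2 * f l := by
  have hfC : IntervalIntegrable (fun l => (f l : ℂ)) volume (-Real.pi) Real.pi :=
    ⟨hint.1.ofReal, hint.2.ofReal⟩
  have hterm : ∀ i j : ℕ, IntervalIntegrable (fun l : ℝ => ((a i * a j : ℝ) : ℂ) *
      (Complex.exp (Complex.I * (((t - i) - (t - j) : ℤ) : ℂ) * l) * (f l : ℂ))) volume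
      (-Real.pi) Real.pi := fun i j =>
    (hfC.continuousOn_mul (by fun_prop)).const_mul _
  have hpt : ∀ l : ℝ,
      ((‖∑ j ∈ Finset.range n, (a j : ℂ) * Complex.exp (Complex.I * l) ^ j‖ ^ 2 * f l : ℝ) : ℂ) =
      ∑ i ∈ Finset.range n, ∑ j ∈ Finset.range n, ((a i * a j : ℝ) : ℂ) *
        (Complex.exp (Complex.I * (((t - i) - (t - j) : ℤ) : ℂ) * l) * (f l : ℂ)) := by
    intro l
    rw [Complex.ofReal_mul, ← Complex.normSq_eq_norm_sq, ← Complex.mul_conj, mul_comm (Finset.sum _ _),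
      map_sum, Finset.sum_mul_sum, Finset.sum_mul]
    refine Finset.sum_congr rfl fun i _ => ?_
    rw [Finset.sum_mul]
    refine Finset.sum_congr rfl fun j _ => ?_
    simp only [map_mul, map_pow, Complex.conj_ofReal, ← Complex.exp_conj, Complex.conj_I]
    rw [← Complex.exp_nat_mul, ← Complex.exp_nat_mul,
      show Complex.I * ((t - i - (t - j) : ℤ) : ℂ) * l =
        i * (-Complex.I * l) + j * (Complex.I * l) by push_cast; ring, Complex.exp_add]
    push_cast; ring
  apply Complex.ofReal_injective
  rw [← intervalIntegral.integral_ofReal]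
  simp_rw [hpt]
  have hsum : ∀ i : ℕ, IntervalIntegrable (fun l : ℝ => ∑ j ∈ Finset.range n,
      ((a i * a j : ℝ) : ℂ) * (Complex.exp (Complex.I * (((t - i) - (t - j) : ℤ) : ℂ) * l) *
        (f l : ℂ))) volume (-Real.pi) Real.pi := by
    intro i
    simpa only [Finset.sum_fn] using
      IntervalIntegrable.sum (Finset.range n) fun j _ => hterm i j
  rw [intervalIntegral.integral_finsetSum fun i _ => hsum i]
  rw [← real_inner_self_eq_norm_sq, sum_inner, Finset.mul_sum, Complex.ofReal_sum]
  refine Finset.sum_congr rfl fun i _ => ?_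
  rw [intervalIntegral.integral_finsetSum fun j _ => hterm i j, inner_sum, Finset.mul_sum,
    Complex.ofReal_sum]
  refine Finset.sum_congr rfl fun j _ => ?_
  rw [intervalIntegral.integral_const_mul, ← hx, ← Complex.ofReal_mul, real_inner_smul_left,
    real_inner_smul_right]
  congr 1; ring

theorem norm_sq_eq_integral_of_hasSum (hint : IntervalIntegrable f volume (-Real.pi) Real.pi)
    (hx : ∀ s t : ℤ, ((κ * inner ℝ (x s) (x t) : ℝ) : ℂ) =
      ∫ l in (-Real.pi)..Real.pi, Complex.exp (Complex.I * ((s - t : ℤ) : ℂ) * l) * (f l : ℂ))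
    {t : ℤ} {a : ℕ → ℝ} (ha : Summable fun j => |a j|) {y : K}
    (hy : HasSum (fun j : ℕ => a j • x (t - j)) y) {A : ℝ → ℂ}
    (hA : ∀ l : ℝ, HasSum (fun j : ℕ => (a j : ℂ) * Complex.exp (Complex.I * l) ^ j) (A l)) :
    κ * ‖y‖ ^ 2 = ∫ l in (-Real.pi)..Real.pi, ‖A l‖ ^ 2 * f l := by
  have h1 : Tendsto (fun n => κ * ‖∑ j ∈ Finset.range n, a j • x (t - j)‖ ^ 2) atTop
      (𝓝 (κ * ‖y‖ ^ 2)) := (hy.tendsto_sum_nat.norm.pow 2).const_mul κ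
  refine tendsto_nhds_unique h1 ?_
  simp_rw [norm_sq_sum_eq_integral hint hx]
  refine intervalIntegral.tendsto_integral_filter_of_dominated_convergence
    (fun l => (∑' j, |a j|) ^ 2 * |f l|) ?_ ?_ (hint.abs.const_mul _) ?_
  · refine Eventually.of_forall fun n => ?_
    rw [intervalIntegrable_iff] at hint
    exact (by fun_prop : Continuous fun l : ℝ => ‖∑ j ∈ Finset.range n,
      (a j : ℂ) * Complex.exp (Complex.I * l) ^ j‖ ^ 2).aestronglyMeasurable.mul hint.1
  · refine Eventually.of_forall fun n => ae_of_all _ fun l _ => ?_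
    rw [norm_mul, norm_pow, norm_norm, Real.norm_eq_abs]
    gcongr
    refine (norm_sum_le _ _).trans ((le_of_eq ?_).trans (ha.sum_le_tsum (Finset.range n)
      fun _ _ => abs_nonneg _))
    refine Finset.sum_congr rfl fun j _ => ?_
    rw [norm_mul, norm_pow, norm_exp_I_mul, one_pow, mul_one, Complex.norm_real, Real.norm_eq_abs]
  · exact ae_of_all _ fun l _ => ((hA l).tendsto_sum_nat.norm.pow 2).mul_const _

end SpectralNorm

/-! ### The moving average modelled in ℓ²(ℤ). -/

section MovingAverage

variable {c : ℕ → ℝ}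

/-- The coefficients `k ↦ c (t - k)` of a one-sided moving average at time `t`. -/
def maCoeff (c : ℕ → ℝ) (t k : ℤ) : ℝ := if k ≤ t then c (t - k).toNat else 0

theorem maCoeff_sub (c : ℕ → ℝ) (t : ℤ) (j : ℕ) : maCoeff c t (t - j) = c j := by
  simp [maCoeff]

theorem maCoeff_of_lt (c : ℕ → ℝ) {t k : ℤ} (h : t < k) : maCoeff c t k = 0 := by
  simp [maCoeff, h]

theorem hasSum_int_iff_of_forall_lt {E : Type*} [AddCommMonoid E] [TopologicalSpace E] {F : ℤ → E}
    {t : ℤ} (hF : ∀ k, t < k → F k = 0) {s : E} :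
    HasSum (fun j : ℕ => F (t - j)) s ↔ HasSum F s := by
  have hinj : Function.Injective fun j : ℕ => t - (j : ℤ) := by
    intro i j h
    simp only at h
    omega
  refine hinj.hasSum_iff fun k hk => hF k ?_
  by_contra! h
  exact hk ⟨(t - k).toNat, by simp only; omega⟩

/-- The vector `k ↦ c (t - k)` of `ℓ²(ℤ)`. -/
noncomputable def maVector (c : ℕ → ℝ) (hc : Summable fun j => c j ^ 2) (t : ℤ) :
    lp (fun _ : ℤ => ℝ) 2 :=
  ⟨maCoeff c t, memℓp_gen (by
    have h := (hasSum_int_iff_of_forall_lt (t := t) (F := fun k => maCoeff c t k ^ 2)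
      (s := ∑' j, c j ^ 2) (fun k hk => by simp [maCoeff_of_lt c hk])).1
      (by simpa only [maCoeff_sub] using hc.hasSum)
    simpa using h.summable)⟩

theorem maVector_apply (hc : Summable fun j => c j ^ 2) (t k : ℤ) :
    maVector c hc t k = maCoeff c t k := rfl

theorem inner_maVector (hc : Summable fun j => c j ^ 2) (t : ℤ) (h : ℕ) :
    inner ℝ (maVector c hc (t + h)) (maVector c hc t) = ∑' k, c k * c (k + h) := by
  have h1 := lp.hasSum_inner (𝕜 := ℝ) (maVector c hc (t + h)) (maVector c hc t)
  rw [← hasSum_int_iff_of_forall_lt (t := t)] at h1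
  · rw [← h1.tsum_eq]
    refine tsum_congr fun j => ?_
    rw [maVector_apply, maVector_apply, maCoeff_sub,
      show t - (j : ℤ) = t + h - ((j + h : ℕ) : ℤ) by push_cast; ring, maCoeff_sub]
    simp
  · intro k hk
    simp [maVector_apply, maCoeff_of_lt c hk]

theorem hasSum_single_maVector (hc : Summable fun j => c j ^ 2) (t : ℤ) :
    HasSum (fun j : ℕ => c j • (lp.single 2 (t - j) 1 : lp (fun _ : ℤ => ℝ) 2))
      (maVector c hc t) := by
  have h1 := lp.hasSum_single (p := 2) (by simp) (maVector c hc t)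
  rw [← hasSum_int_iff_of_forall_lt (t := t)] at h1
  · refine h1.congr_fun fun j => ?_
    rw [maVector_apply, maCoeff_sub, ← lp.single_smul, smul_eq_mul, mul_one]
  · intro k hk
    simp [maVector_apply, maCoeff_of_lt c hk]

theorem inner_single_maVector (hc : Summable fun j => c j ^ 2) (s t : ℤ) :
    inner ℝ (lp.single 2 s 1 : lp (fun _ : ℤ => ℝ) 2) (maVector c hc t) = maCoeff c t s := by
  rw [lp.inner_single_left]
  simp [maVector_apply]

/-- The vectors `y r = ∑ b_j r^j x_{t-j}` apply an approximate inverse of the moving average, and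
they tend to `e_t` as `r ↑ 1`. Indeed `⟨e_t, y r⟩ = 1` and `‖e_t‖ = 1`, so `‖y r - e_t‖² = ‖y r‖² -
1`, while `σ² ‖y r‖²` is the spectral integral of `|h(0) / h(r e^{il})|² f`, which tends to `σ²`. -/
theorem single_sub_maVector_mem {f : ℝ → ℝ} {δ : ℝ}
    (hint : IntervalIntegrable f volume (-Real.pi) Real.pi)
    (hδ : 0 < δ) (hlow : ∀ l, Real.sin l ≠ 0 → δ ≤ f l)
    (hcont : ∀ l, Real.sin l ≠ 0 → ContinuousAt f l) {b : ℕ → ℝ}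
    (hb : ∀ z : ℂ, ‖z‖ < 1 →
      HasSum (fun j : ℕ => (b j : ℂ) * z ^ j) (outerFunction f 0 / outerFunction f z))
    (hc : Summable fun j => c j ^ 2) (hc0 : c 0 = 1)
    (hgram : ∀ s t : ℤ,
      ((innovationVariance f * inner ℝ (maVector c hc s) (maVector c hc t) : ℝ) : ℂ) =
      ∫ l in (-Real.pi)..Real.pi, Complex.exp (Complex.I * ((s - t : ℤ) : ℂ) * l) * (f l : ℂ))
    (t : ℤ) : (lp.single 2 t 1 : lp (fun _ : ℤ => ℝ) 2) - maVector c hc t ∈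
      (Submodule.span ℝ (maVector c hc '' Set.Iio t)).topologicalClosure := by
  set x := maVector c hc with hx
  set e : lp (fun _ : ℤ => ℝ) 2 := lp.single 2 t 1 with he
  have hv := innovationVariance_pos f
  have hb0 : b 0 = 1 := coeff_zero_eq_one
    (F := fun z => outerFunction f 0 / outerFunction f z) (div_self (outerFunction_ne_zero f 0)) hb
  have hnorm : ∀ s, ‖x s‖ = ‖x 0‖ := by
    intro s
    have h1 : inner ℝ (x s) (x s) = inner ℝ (x 0) (x 0) := by
      have h2 := inner_maVector hc s 0
      have h3 := inner_maVector hc 0 0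
      simp only [Nat.cast_zero, add_zero] at h2 h3
      rw [hx, h2, h3]
    rw [real_inner_self_eq_norm_sq, real_inner_self_eq_norm_sq] at h1
    exact (sq_eq_sq₀ (norm_nonneg _) (norm_nonneg _)).1 h1
  -- The factor `r ^ j` makes the coefficients absolutely summable; for the `b j` alone this is not
  -- known.
  have hsum : ∀ r : ℝ, 0 ≤ r → r < 1 → Summable fun j : ℕ => (b j * r ^ j) • x (t - j) := by
    intro r hr hr1
    refine Summable.of_norm ?_
    simp_rw [norm_smul, hnorm]
    exact (summable_abs_mul_pow hb hr hr1).mul_right _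
  set y : ℝ → lp (fun _ : ℤ => ℝ) 2 := fun r => ∑' j : ℕ, (b j * r ^ j) • x (t - j) with hy
  have hmem : ∀ r : ℝ, 0 ≤ r → r < 1 →
      y r - x t ∈ (Submodule.span ℝ (x '' Set.Iio t)).topologicalClosure := by
    intro r hr hr1
    -- As `b 0 = 1`, the term `j = 0` is `x t`; the remaining terms involve only the strict past.
    have h1 := (hasSum_nat_add_iff' 1).2 (hsum r hr hr1).hasSum
    simp only [Finset.sum_range_one, hb0, pow_zero, mul_one, one_smul, Nat.cast_zero, sub_zero]
      at h1
    refine (Submodule.isClosed_topologicalClosure _).mem_of_tendsto h1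
      (Eventually.of_forall fun S => ?_)
    refine Submodule.le_topologicalClosure _ (Submodule.sum_mem _ fun j _ =>
      Submodule.smul_mem _ _ (Submodule.subset_span ⟨_, ?_, rfl⟩))
    simp only [Set.mem_Iio]
    push_cast
    omega
  have hinner : ∀ r : ℝ, 0 ≤ r → r < 1 → inner ℝ e (y r) = (1 : ℝ) := by
    intro r hr hr1
    have h1 : HasSum (fun j : ℕ => inner ℝ e ((b j * r ^ j) • x (t - j))) (inner ℝ e (y r)) :=
      (innerSL ℝ e).hasSum (hsum r hr hr1).hasSum
    refine h1.unique ?_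
    -- For `j > 0` the vector `x (t - j)` has no component at `t`; for `j = 0` the component is `c 0
    -- = 1`.
    have h2 := hasSum_single (f := fun j : ℕ => inner ℝ e ((b j * r ^ j) • x (t - j))) 0
      (fun j hj => by
        rw [real_inner_smul_right, he, hx, inner_single_maVector, maCoeff_of_lt, mul_zero]
        omega)
    convert h2 using 1
    have h3 := maCoeff_sub c t 0
    rw [real_inner_smul_right, he, hx, inner_single_maVector, hb0]
    simp only [Nat.cast_zero, sub_zero] at h3 ⊢
    rw [h3, hc0]
    simp
  have hlim : Tendsto y (𝓝[<] 1) (𝓝 e) := by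
    rw [tendsto_iff_norm_sub_tendsto_zero]
    have h1 := ((tendsto_integral_norm_sq_inv_outerFunction hint hδ hlow hcont).const_mul
      (innovationVariance f)⁻¹).sub_const 1
    rw [inv_mul_cancel₀ hv.ne', sub_self] at h1
    have h2 := (Real.continuous_sqrt.tendsto 0).comp h1
    rw [Real.sqrt_zero] at h2
    refine h2.congr' ?_
    filter_upwards [eventually_mem_Ico_nhdsLT_one] with r hr
    have h3 := norm_sq_eq_integral_of_hasSum hint hgram (summable_abs_mul_pow hb hr.1 hr.2)
      (hsum r hr.1 hr.2).hasSum (hasSum_mul_pow_exp hb hr.1 hr.2)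
    have h4 : ‖y r - e‖ ^ 2 = ‖y r‖ ^ 2 - 1 := by
      rw [norm_sub_sq_real, real_inner_comm, hinner r hr.1 hr.2, he, lp.norm_single (by simp)]
      norm_num
      ring
    rw [Function.comp_apply, ← h3, inv_mul_cancel_left₀ hv.ne', ← Real.sqrt_sq (norm_nonneg (y r - e)), h4]
  refine (Submodule.isClosed_topologicalClosure _).mem_of_tendsto (hlim.sub_const (x t)) ?_
  filter_upwards [eventually_mem_Ico_nhdsLT_one] with r hr using hmem r hr.1 hr.2

/-- Adding `x_k` back shows that every basis vector `e_k` is in the closed span. -/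
theorem topologicalClosure_span_maVector (hc : Summable fun j => c j ^ 2)
    (h : ∀ t, (lp.single 2 t 1 : lp (fun _ : ℤ => ℝ) 2) - maVector c hc t ∈
      (Submodule.span ℝ (maVector c hc '' Set.Iio t)).topologicalClosure) :
    (Submodule.span ℝ (Set.range (maVector c hc))).topologicalClosure = ⊤ := by
  rw [eq_top_iff]
  rintro w -
  have hsingle : ∀ k, (lp.single 2 k 1 : lp (fun _ : ℤ => ℝ) 2) ∈
      (Submodule.span ℝ (Set.range (maVector c hc))).topologicalClosure := by
    intro k
    have h1 := Submodule.topologicalClosure_mono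
      (Submodule.span_mono (Set.image_subset_range (maVector c hc) (Set.Iio k))) (h k)
    have h2 := Submodule.le_topologicalClosure _
      (Submodule.subset_span (R := ℝ) (Set.mem_range_self (f := maVector c hc) k))
    simpa using Submodule.add_mem _ h1 h2
  refine (Submodule.isClosed_topologicalClosure _).mem_of_tendsto
    (lp.hasSum_single (p := 2) (by simp) w) (Eventually.of_forall fun S => ?_)
  refine Submodule.sum_mem _ fun k _ => ?_
  have := Submodule.smul_mem _ (w k) (hsingle k)
  rwa [← lp.single_smul, smul_eq_mul, mul_one] at this

end MovingAverage

/-! ### Gaussianity and independence through characteristic functions. -/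

section Gaussian

variable {Ω : Type*} [MeasurableSpace Ω] {P : Measure Ω}

theorem coeFn_sum_smul {ι : Type*} (S : Finset ι) (c : ι → ℝ) (w : ι → Lp ℝ 2 P) :
    ⇑(∑ s ∈ S, c s • w s) =ᵐ[P] fun ω => ∑ s ∈ S, c s * w s ω := by
  have h : ∀ᵐ ω ∂P, ∀ s ∈ S, (c s • w s : Lp ℝ 2 P) ω = c s * w s ω := by
    rw [Finset.eventually_all]
    exact fun s _ => Lp.coeFn_smul (c s) (w s)
  filter_upwards [h, Lp.coeFn_finsetSum S (fun s => c s • w s)] with ω h1 h2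
  rw [h2, Finset.sum_apply]
  exact Finset.sum_congr rfl h1

theorem norm_exp_I_mul_sub_le (x y : ℝ) :
    ‖Complex.exp (Complex.I * x) - Complex.exp (Complex.I * y)‖ ≤ ‖x - y‖ := by
  have h : Complex.exp (Complex.I * x) - Complex.exp (Complex.I * y) =
      Complex.exp (Complex.I * y) * (Complex.exp (Complex.I * ((x - y : ℝ) : ℂ)) - 1) := by
    rw [mul_sub, ← Complex.exp_add]
    push_cast; ring_nf
  rw [h, norm_mul, norm_exp_I_mul, one_mul]
  exact Real.norm_exp_I_mul_ofReal_sub_one_le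

variable [IsProbabilityMeasure P]

theorem integrable_exp_I_mul {g : Ω → ℝ} (hg : AEStronglyMeasurable g P) :
    Integrable (fun ω => Complex.exp (Complex.I * (g ω : ℂ))) P := by
  refine Integrable.of_bound (C := 1) ?_ (ae_of_all _ fun ω => (norm_exp_I_mul _).le)
  exact (by fun_prop : Continuous fun x : ℝ => Complex.exp (Complex.I * x)).comp_aestronglyMeasurable
    hg

/-- The map is 1-Lipschitz, since `|e^{ix} - e^{iy}| ≤ |x - y|` and the L¹ norm is at most the L²
norm on a probability space. It lets the Gaussian formula pass to L² limits. -/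
theorem continuous_integral_exp_I_mul :
    Continuous fun w : Lp ℝ 2 P => ∫ ω, Complex.exp (Complex.I * (w ω : ℂ)) ∂P := by
  refine (LipschitzWith.of_dist_le_mul (K := 1) fun u w => ?_).continuous
  have hu := integrable_exp_I_mul (Lp.aestronglyMeasurable u)
  have hw := integrable_exp_I_mul (Lp.aestronglyMeasurable w)
  rw [dist_eq_norm, dist_eq_norm, ← integral_sub hu hw, NNReal.coe_one, one_mul]
  have hm := Lp.memLp (u - w)
  have h1 : ∫ ω, ‖(u - w) ω‖ ∂P ≤ ‖u - w‖ := by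
    rw [Lp.norm_def, integral_norm_eq_lintegral_enorm hm.1, ← eLpNorm_one_eq_lintegral_enorm]
    exact ENNReal.toReal_mono hm.2.ne (eLpNorm_le_eLpNorm_of_exponent_le (by norm_num) hm.1)
  refine (norm_integral_le_integral_norm _).trans (le_trans ?_ h1)
  refine integral_mono_ae (hu.sub hw).norm (hm.integrable one_le_two).norm ?_
  filter_upwards [Lp.coeFn_sub u w] with ω hω
  rw [hω]
  exact norm_exp_I_mul_sub_le _ _

/-- The exponent is a sum of squares, so each finite joint characteristic function is the product of
the marginal ones. -/
theorem iIndepFun_of_integral_exp {Z : ℤ → Ω → ℝ} (hZ : ∀ t, Measurable (Z t)) {κ : ℝ}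
    (h : ∀ (S : Finset ℤ) (c : ℤ → ℝ),
      ∫ ω, Complex.exp (Complex.I * ((∑ t ∈ S, c t * Z t ω : ℝ) : ℂ)) ∂P =
        Complex.exp (-((κ * ∑ t ∈ S, c t ^ 2 : ℝ) : ℂ) / 2)) :
    iIndepFun Z P := by
  classical
  have hone : ∀ t x, charFun (P.map (Z t)) x = Complex.exp (-((κ * x ^ 2 : ℝ) : ℂ) / 2) := by
    intro t x
    have := h {t} (fun _ => x)
    simp only [Finset.sum_singleton] at this
    rw [← this, charFun_apply_real, integral_map (hZ t).aemeasurable (by fun_prop)]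
    congr 1; ext ω; congr 1; push_cast; ring
  rw [iIndepFun_iff_finset]
  intro S
  rw [iIndepFun_iff_charFun_pi (X := S.restrict Z) fun i => (hZ i.1).aemeasurable]
  intro x
  -- The hypothesis wants coefficients on all of `ℤ`; their values off `S` do not matter.
  have hx := h S (fun t => if ht : t ∈ S then x ⟨t, ht⟩ else 0)
  have hs : ∀ g : ℤ → ℝ → ℝ, ∑ t ∈ S, g t (if ht : t ∈ S then x ⟨t, ht⟩ else 0) =
      ∑ t : {t // t ∈ S}, g t (x t) := by
    intro g
    rw [← Finset.sum_coe_sort S]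
    refine Finset.sum_congr rfl fun t _ => ?_
    rw [dif_pos t.2]
  have hmeas : Measurable fun ω => WithLp.toLp 2 (fun t : {t // t ∈ S} => Z t ω) := by fun_prop
  simp only [Finset.restrict_def]
  rw [charFun_apply, integral_map hmeas.aemeasurable (by fun_prop)]
  simp only [hone]
  rw [← Complex.exp_sum]
  refine Eq.trans ?_ (hx.trans ?_)
  · congr 1
    ext ω
    rw [hs (fun t y => y * Z t ω), mul_comm Complex.I]
    congr 3
  · rw [hs (fun _ y => y ^ 2), Finset.mul_sum]
    congr 1
    push_cast
    rw [← Finset.sum_neg_distrib, Finset.sum_div]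

theorem map_eq_gaussianReal_of_integral_exp {Z : Ω → ℝ} (hZ : Measurable Z) {κ : ℝ} (hκ : 0 ≤ κ)
    (h : ∀ c : ℝ, ∫ ω, Complex.exp (Complex.I * ((c * Z ω : ℝ) : ℂ)) ∂P =
        Complex.exp (-((κ * c ^ 2 : ℝ) : ℂ) / 2)) :
    P.map Z = gaussianReal 0 κ.toNNReal := by
  have : IsProbabilityMeasure (P.map Z) := Measure.isProbabilityMeasure_map hZ.aemeasurable
  refine Measure.ext_of_charFun ?_
  ext x
  rw [charFun_gaussianReal, charFun_apply_real, integral_map hZ.aemeasurable (by fun_prop),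
    Real.coe_toNNReal _ hκ]
  refine Eq.trans ?_ ((h x).trans ?_)
  · congr 1; ext ω; congr 1; push_cast; ring
  · congr 1; push_cast; ring

end Gaussian

/-! ### Best linear prediction and the Wold representation. -/

section Wold

variable {Ω : Type*} [MeasurableSpace Ω] {P : Measure Ω}

/-- The two conditions say that `X t - w` is the orthogonal projection of `X t` onto the closed span
of the past; minimality is Pythagoras. -/
theorem isBestLinearPredictor_of_mem_closure {X : ℤ → Ω → ℝ} (hm : ∀ t, MemLp (X t) 2 P) {t : ℤ}
    {w : Lp ℝ 2 P} (hw : (hm t).toLp - w ∈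
      (Submodule.span ℝ ((fun s => (hm s).toLp) '' Set.Iio t)).topologicalClosure)
    (ho : ∀ s < t, inner ℝ w (hm s).toLp = (0 : ℝ)) :
    IsBestLinearPredictor P X t (fun ω => X t ω - w ω) := by
  set x : ℤ → Lp ℝ 2 P := fun s => (hm s).toLp with hx
  set M := Submodule.span ℝ (x '' Set.Iio t) with hM
  have hcomb : ∀ (S : Finset ℤ) (c : ℤ → ℝ),
      (fun ω => ∑ s ∈ S, c s * X s ω) =ᵐ[P] ⇑(∑ s ∈ S, c s • x s) := by
    intro S c
    have h : ∀ᵐ ω ∂P, ∀ s ∈ S, x s ω = X s ω := by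
      rw [Finset.eventually_all]
      exact fun s _ => (hm s).coeFn_toLp
    filter_upwards [coeFn_sum_smul S c x, h] with ω h1 h2
    rw [h1]
    exact Finset.sum_congr rfl fun s hs => by rw [h2 s hs]
  refine ⟨(hm t).sub (Lp.memLp w), fun δ hδ => ?_, fun S c hS => ?_⟩
  · have hw' : x t - w ∈ closure (M : Set (Lp ℝ 2 P)) := hw
    obtain ⟨p, hp, hpd⟩ := EMetric.mem_closure_iff.1 hw' δ hδ
    obtain ⟨a, ha, rfl⟩ := (Finsupp.mem_span_image_iff_linearCombination ℝ).1 hp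
    refine ⟨a.support, a, fun s hs => (Finsupp.mem_supported ℝ a).1 ha hs, ?_⟩
    rw [edist_eq_enorm_sub, Finsupp.linearCombination_apply, Finsupp.sum, Lp.enorm_def] at hpd
    refine lt_of_eq_of_lt (eLpNorm_congr_ae ?_) hpd
    filter_upwards [Lp.coeFn_sub (x t - w) (∑ s ∈ a.support, a s • x s), Lp.coeFn_sub (x t) w,
      hcomb a.support a, (hm t).coeFn_toLp] with ω h1 h2 h3 h4
    rw [h1, Pi.sub_apply, ← h3, h2, Pi.sub_apply, ← h4]
  · have hp : ∑ s ∈ S, c s • x s ∈ M := Submodule.sum_mem _ fun s hs =>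
      Submodule.smul_mem _ _ (Submodule.subset_span ⟨s, hS s hs, rfl⟩)
    have horth : ∀ q ∈ M.topologicalClosure, inner ℝ w q = (0 : ℝ) := by
      intro q hq
      have hle : M.topologicalClosure ≤ LinearMap.ker (innerSL ℝ w).toLinearMap := by
        refine Submodule.topologicalClosure_minimal _ (Submodule.span_le.2 ?_)
          (innerSL ℝ w).isClosed_ker
        rintro _ ⟨s, hs, rfl⟩
        exact ho s hs
      exact hle hq
    have hq := M.topologicalClosure.sub_mem hw (M.le_topologicalClosure hp)
    have hnorm : ‖w‖ ≤ ‖x t - ∑ s ∈ S, c s • x s‖ := by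
      have h1 : x t - ∑ s ∈ S, c s • x s = w + (x t - w - ∑ s ∈ S, c s • x s) := by abel
      have h2 := horth _ hq
      rw [h1]
      refine le_of_sq_le_sq ?_ (norm_nonneg _)
      rw [norm_add_sq_real, h2]
      nlinarith [sq_nonneg ‖x t - w - ∑ s ∈ S, c s • x s‖]
    have e1 : eLpNorm (fun ω => X t ω - (X t ω - w ω)) 2 P = ‖w‖ₑ := by
      simp only [sub_sub_cancel]
      rw [Lp.enorm_def]
    have e2 : eLpNorm (fun ω => X t ω - ∑ s ∈ S, c s * X s ω) 2 P =
        ‖x t - ∑ s ∈ S, c s • x s‖ₑ := by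
      rw [Lp.enorm_def]
      refine eLpNorm_congr_ae ?_
      filter_upwards [Lp.coeFn_sub (x t) (∑ s ∈ S, c s • x s), hcomb S c, (hm t).coeFn_toLp]
        with ω h1 h2 h3
      rw [h1, Pi.sub_apply, ← h2, ← h3]
    rw [e1, e2, enorm_le_iff_norm_le]
    exact hnorm

variable [IsProbabilityMeasure P]

/-- A Gaussian process whose covariance function is that of the spectral density `f` has the Wold
representation given by the outer function of `f`. -/
theorem exists_isWoldRepresentation {f : ℝ → ℝ} {δ : ℝ} (hev : ∀ l, f (-l) = f l)
    (hint : IntervalIntegrable f volume (-Real.pi) Real.pi)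
    (hδ : 0 < δ) (hlow : ∀ l, Real.sin l ≠ 0 → δ ≤ f l)
    (hcont : ∀ l, Real.sin l ≠ 0 → ContinuousAt f l)
    {X : ℤ → Ω → ℝ} (hm : ∀ t, MemLp (X t) 2 P)
    (hcov : ∀ s t : ℤ, ((∫ ω, X s ω * X t ω ∂P : ℝ) : ℂ) = ∫ l in (-Real.pi)..Real.pi,
      Complex.exp (Complex.I * ((s - t : ℤ) : ℂ) * l) * (f l : ℂ))
    (hgauss : ∀ (S : Finset ℤ) (c : ℤ → ℝ),
      ∫ ω, Complex.exp (Complex.I * ((∑ t ∈ S, c t * X t ω : ℝ) : ℂ)) ∂P =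
        Complex.exp (-((∫ ω, (∑ t ∈ S, c t * X t ω) ^ 2 ∂P : ℝ) : ℂ) / 2)) :
    ∃ (c : ℕ → ℝ) (Z : ℤ → Ω → ℝ), IsWoldRepresentation P X f c Z ∧ (∀ t, Measurable (Z t)) ∧
      iIndepFun Z P ∧ ∀ t, P.map (Z t) = gaussianReal 0 (innovationVariance f).toNNReal := by
  have hlog := intervalIntegrable_log_of_le hint hδ hlow
  have hv := innovationVariance_pos f
  obtain ⟨c, hc⟩ := exists_taylor_outerFunction hev hlog
  obtain ⟨b, hb⟩ := exists_taylor_inv_outerFunction hev hlog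
  have hc0 : c 0 = 1 := coeff_zero_eq_one
    (F := fun z => outerFunction f z / outerFunction f 0) (div_self (outerFunction_ne_zero f 0)) hc
  have hsq := summable_sq_taylor_outerFunction hint hδ hlow hc
  have hgram : ∀ s t : ℤ,
      ((innovationVariance f * inner ℝ (maVector c hsq s) (maVector c hsq t) : ℝ) : ℂ) =
      ∫ l in (-Real.pi)..Real.pi, Complex.exp (Complex.I * ((s - t : ℤ) : ℂ) * l) * (f l : ℂ) := by
    intro s t
    rw [integral_exp_mul_even hev, ← innovationVariance_mul_tsum hint hδ hlow hcont hc]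
    rcases le_total t s with h | h
    · obtain ⟨n, rfl⟩ := Int.le.dest h
      rw [inner_maVector, add_sub_cancel_left, Int.natAbs_natCast]
    · obtain ⟨n, rfl⟩ := Int.le.dest h
      rw [real_inner_comm, inner_maVector, sub_add_cancel_left, Int.natAbs_neg,
        Int.natAbs_natCast]
  set x := maVector c hsq with hx
  set e : ℤ → lp (fun _ : ℤ => ℝ) 2 := fun t => lp.single 2 t 1 with he
  have hmem : ∀ t, e t - x t ∈ (Submodule.span ℝ (x '' Set.Iio t)).topologicalClosure :=
    single_sub_maVector_mem hint hδ hlow hcont hb hsq hc0 hgram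
  have hdense := topologicalClosure_span_maVector hsq hmem
  -- `V` carries the model to the process. The innovations will be the images `V (e t)` of the
  -- standard basis.
  obtain ⟨V, hVx, hV⟩ := exists_continuousLinearMap_of_inner_eq (x := x)
    (X := fun t => (hm t).toLp) hv.le hdense (fun s t => by
      apply Complex.ofReal_injective
      rw [hgram, inner_toLp_eq_integral, hcov])
  have hVgauss : ∀ u, ∫ ω, Complex.exp (Complex.I * (V u ω : ℂ)) ∂P =
      Complex.exp (-((innovationVariance f * ‖u‖ ^ 2 : ℝ) : ℂ) / 2) := by
    -- On finite combinations of the `x t` the formula is the Gaussian hypothesis on `X`; both sides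
    -- are continuous in `u`, so it extends to all of ℓ²(ℤ).
    have hd : DenseRange (Finsupp.linearCombination ℝ x) := by
      have : Dense ((Submodule.span ℝ (Set.range x) : Submodule ℝ _) :
          Set (lp (fun _ : ℤ => ℝ) 2)) := by
        rw [Submodule.dense_iff_topologicalClosure_eq_top, hdense]
      rwa [← Finsupp.range_linearCombination] at this
    intro u
    refine hd.induction_on (p := fun u => ∫ ω, Complex.exp (Complex.I * (V u ω : ℂ)) ∂P =
      Complex.exp (-((innovationVariance f * ‖u‖ ^ 2 : ℝ) : ℂ) / 2)) u ?_ fun a => ?_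
    · exact isClosed_eq (continuous_integral_exp_I_mul.comp V.continuous) (by fun_prop)
    · rw [← real_inner_self_eq_norm_sq, ← hV, ← Complex.ofReal_neg]
      have h1 : V (Finsupp.linearCombination ℝ x a) =
          ∑ t ∈ a.support, a t • (hm t).toLp := by
        simp [Finsupp.linearCombination_apply, Finsupp.sum, hVx]
      have h2 : ⇑(V (Finsupp.linearCombination ℝ x a)) =ᵐ[P]
          fun ω => ∑ t ∈ a.support, a t * X t ω := by
        have h : ∀ᵐ ω ∂P, ∀ s ∈ a.support, (hm s).toLp (X s) ω = X s ω := by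
          rw [Finset.eventually_all]
          exact fun s _ => (hm s).coeFn_toLp
        rw [h1]
        filter_upwards [coeFn_sum_smul a.support a fun t => (hm t).toLp, h] with ω h3 h4
        rw [h3]
        exact Finset.sum_congr rfl fun s hs => by rw [h4 s hs]
      have h3 : inner ℝ (V (Finsupp.linearCombination ℝ x a))
          (V (Finsupp.linearCombination ℝ x a)) =
          ∫ ω, (∑ t ∈ a.support, a t * X t ω) ^ 2 ∂P := by
        rw [L2.inner_def]
        refine integral_congr_ae ?_
        filter_upwards [h2] with ω hω
        rw [hω]
        simp [sq]
      rw [h3, Complex.ofReal_neg, ← hgauss]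
      refine integral_congr_ae ?_
      filter_upwards [h2] with ω hω
      rw [hω]
  have hZm : ∀ t, Measurable (V (e t) : Ω → ℝ) := fun t => (Lp.stronglyMeasurable _).measurable
  have hZexp : ∀ (S : Finset ℤ) (a : ℤ → ℝ),
      ∫ ω, Complex.exp (Complex.I * ((∑ t ∈ S, a t * V (e t) ω : ℝ) : ℂ)) ∂P =
        Complex.exp (-((innovationVariance f * ∑ t ∈ S, a t ^ 2 : ℝ) : ℂ) / 2) := by
    intro S a
    -- Orthonormality of the basis removes the cross terms, which is what yields independence.
    have h1 : ‖∑ t ∈ S, a t • e t‖ ^ 2 = ∑ t ∈ S, a t ^ 2 := by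
      have := lp.norm_sum_single (p := 2) (by simp) a S
      simpa [he, ← lp.single_smul] using this
    rw [← h1, ← hVgauss, map_sum]
    simp_rw [map_smul]
    refine integral_congr_ae ?_
    filter_upwards [coeFn_sum_smul S a fun t => V (e t)] with ω hω
    rw [hω]
  refine ⟨c, fun t => V (e t), ⟨hc0, hsq, hc, fun t => ?_, fun t => ?_⟩, hZm,
    iIndepFun_of_integral_exp hZm hZexp, fun t =>
      map_eq_gaussianReal_of_integral_exp (hZm t) hv.le fun y => by
        simpa using hZexp {t} fun _ => y⟩
  · refine isBestLinearPredictor_of_mem_closure hm ?_ fun s hs => ?_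
    · have h1 : V (e t - x t) ∈
          ((Submodule.span ℝ (x '' Set.Iio t)).map V.toLinearMap).topologicalClosure :=
        map_mem_closure V.continuous (hmem t) fun y hy => Submodule.mem_map_of_mem hy
      rw [Submodule.map_span, Set.image_image] at h1
      have h2 := Submodule.neg_mem _ h1
      simpa only [map_sub, hVx, neg_sub, ContinuousLinearMap.coe_coe] using h2
    -- For `s < t` the one-sided moving average `x s` has no component at `t`.
    · rw [← hVx, hV, he, hx, inner_single_maVector, maCoeff_of_lt c hs, mul_zero]
  -- The representation is the image under `V` of the expansion of `x t` in the standard basis.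
  · have h1 := (V.hasSum (hasSum_single_maVector hsq t)).tendsto_sum_nat
    rw [← hx, hVx, tendsto_iff_norm_sub_tendsto_zero] at h1
    have h2 := (ENNReal.continuous_ofReal.tendsto 0).comp h1
    rw [ENNReal.ofReal_zero] at h2
    refine h2.congr fun n => ?_
    rw [Function.comp_apply, norm_sub_rev, ofReal_norm, Lp.enorm_def]
    refine eLpNorm_congr_ae ?_
    simp_rw [map_smul]
    filter_upwards [Lp.coeFn_sub ((hm t).toLp)
      (∑ j ∈ Finset.range n, c j • V (lp.single 2 (t - (j : ℤ)) 1)), (hm t).coeFn_toLp,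
      coeFn_sum_smul (Finset.range n) c fun j : ℕ => V (lp.single 2 (t - (j : ℤ)) 1)]
      with ω h3 h4 h5
    rw [h3, Pi.sub_apply, h4, h5]

end Wold

end AggregatedAR

/-! ### Assembly. -/

theorem mainTheorem2
    (φ ψ : ℝ → ℝ) (d v : ℝ)
    (hφ : AggregatedAR.IsMixtureDensity φ)
    (hB : AggregatedAR.HasSemiparametricForm φ ψ d)
    (hψ : AggregatedAR.FullSupportCondition ψ ∨ AggregatedAR.SeparatedSupportCondition ψ)
    {Ω' : Type*} [MeasurableSpace Ω'] (P' : Measure Ω') [IsProbabilityMeasure P']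
    (a : ℕ → Ω' → ℝ) (ε Y : ℕ → ℤ → Ω' → ℝ)
    (hY : AggregatedAR.IsRandomCoeffAR1 P' φ v a ε Y)
    {Ω : Type*} [MeasurableSpace Ω] (P : Measure Ω) [IsProbabilityMeasure P]
    (X : ℤ → Ω → ℝ)
    (hX : AggregatedAR.IsAggregatedProcess P' Y P X) :
    let f : ℝ → ℝ := AggregatedAR.spectralDensity φ v
    AggregatedAR.HasSpectralDensity P X f ∧
    (∀ᵐ l ∂(volume.restrict (Set.Icc (-Real.pi) Real.pi)), 0 < f l) ∧
    IntervalIntegrable (fun l => Real.log (f l)) volume (-Real.pi) Real.pi ∧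
    ∃ (c : ℕ → ℝ) (Z : ℤ → Ω → ℝ),
      AggregatedAR.IsWoldRepresentation P X f c Z ∧
      (∀ t, Measurable (Z t)) ∧
      iIndepFun Z P ∧
      ∀ t, P.map (Z t) = gaussianReal 0 (AggregatedAR.innovationVariance f).toNNReal := by
  intro f
  have hv := hY.variance_pos
  have hint := AggregatedAR.intervalIntegrable_spectralDensity (v := v) hφ
  have hδ : 0 < v / (8 * Real.pi) := by positivity
  have hlow : ∀ l, Real.sin l ≠ 0 → v / (8 * Real.pi) ≤ f l := fun l hl =>
    AggregatedAR.le_spectralDensity hφ hv hl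
  have hm := hX.memLp hφ hY
  refine ⟨⟨hm, AggregatedAR.spectralDensity_nonneg hφ hv, hint, fun t h => ?_⟩, ?_,
    AggregatedAR.intervalIntegrable_log_of_le hint hδ hlow,
    AggregatedAR.exists_isWoldRepresentation (AggregatedAR.spectralDensity_neg φ v) hint hδ hlow
      (fun l hl => AggregatedAR.continuousAt_spectralDensity hφ hl) hm (fun s t => ?_)
      (hX.integral_exp_sum hφ hY)⟩
  · rw [hX.covariance_eq hφ hY, add_sub_cancel_left,
      AggregatedAR.integral_exp_mul_spectralDensity hφ]
  · rw [Measure.restrict_congr_set Ioc_ae_eq_Icc.symm]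
    filter_upwards [AggregatedAR.ae_sin_ne_zero] with l hl using hδ.trans_le (hlow l hl)
  · rw [hX.integral_mul hφ hY, AggregatedAR.integral_exp_mul_spectralDensity hφ]
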